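/- Proposition. Two settings are treated. (1) Varieties. Let $k$ be an algebraically closed field (for instance $k=\mathbb C$), let $X$ be a smooth variety over $k$ (an integral separated scheme of finite type that is smooth over $k$), and let $S, T\subseteq X$ be closed subvarieties that are smooth over $k$. Suppose that the scheme-theoretic intersection $W=S\times_X T$ is smooth over $k$ (so that in particular $T_{W,w}=T_{S,w}\cap T_{T,w}$ at every closed point $w\in W$). Then every point $w\in W$ has an open neighbourhood $U\subseteq X$ for which there is a closed subvariety $Y\subseteq U$, smooth over $k$, such that a) $S\cap U\subseteq Y$ (hence $w\in Y$); b) $W\cap U$ is the scheme-theoretic intersection of $Y$ and $T\cap U$ in $U$; c) $Y$ and $T$ intersect in the expected dimension: $\dim Y+\dim T-\dim X=\dim (W\cap U)$. (2) Complex manifolds. Let $X$ be a complex manifold (of pure finite dimension) and let $S, T\subseteq X$ be closed complex submanifolds (whose components may have different dimensions). Suppose that $W=S\cap T$ is a complex submanifold of $X$ and that $T_{W,w}=T_{S,w}\cap T_{T,w}$ inside $T_{X,w}$ for every $w\in W$. Then every point $w\in W$ has an open neighbourhood $U\subseteq X$ for which there is a closed complex submanifold $Y\subseteq U$ such that a)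 $S\cap U\subseteq Y$ (hence $w\in Y$); b) $W\cap U$ is the scheme-theoretic intersection of $Y$ and $T\cap U$ in $U$, that is, $W\cap U=Y\cap T\cap U$ and $I_{W,x}=I_{Y,x}+I_{T,x}$ in $\mathcal O_{X,x}$ for every $x\in U$, where $I_{Z,x}$ denotes the ideal of germs of holomorphic functions at $x$ that vanish on $Z$; c) $Y$, $T\cap U$ and $W\cap U$ are of pure dimension, and $\dim Y+\dim (T\cap U)-\dim X=\dim (W\cap U)$. -/

import Mathlib

open CategoryTheory CategoryTheory.Limits AlgebraicGeometry
open scoped Topology Manifold ContDiff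

universe u v

/-- `p : X ⟶ Spec k` exhibits `X` as a smooth variety over `k`: an integral separated scheme of
finite type over `k` that is smooth over `k`. -/
structure IsSmoothVariety {k : Type u} [Field k] {X : Scheme.{u}}
    (p : X ⟶ Spec (CommRingCat.of k)) : Prop where
  isIntegral : IsIntegral X
  isSeparated : IsSeparated p
  locallyOfFiniteType : LocallyOfFiniteType p
  quasiCompact : QuasiCompact p
  smooth : Smooth p

namespace ComplexManifold

/-- `S` is a (locally closed) complex submanifold of `X`, of dimension `d` at the point `x`:
some holomorphic chart of `X` around `x` maps `S` to a `d`-dimensional linear subspace. -/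
def HasSliceChartAt (E : Type u) [NormedAddCommGroup E] [NormedSpace ℂ E]
    {X : Type v} [TopologicalSpace X] [ChartedSpace E X] (S : Set X) (d : ℕ) (x : X) : Prop :=
  ∃ φ ∈ IsManifold.maximalAtlas 𝓘(ℂ, E) ω X, x ∈ φ.source ∧
    ∃ V : Submodule ℂ E, Module.finrank ℂ V = d ∧ ∀ y ∈ φ.source, y ∈ S ↔ φ y ∈ V

/-- `S` is a complex submanifold of `X` (its components may have different dimensions). -/
def IsSubmanifold (E : Type u) [NormedAddCommGroup E] [NormedSpace ℂ E]
    {X : Type v} [TopologicalSpace X] [ChartedSpace E X] (S : Set X) : Prop :=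
  ∀ x ∈ S, ∃ d : ℕ, HasSliceChartAt E S d x

/-- `S` is a complex submanifold of `X` of pure dimension `d`. -/
def IsSubmanifoldOfDim (E : Type u) [NormedAddCommGroup E] [NormedSpace ℂ E]
    {X : Type v} [TopologicalSpace X] [ChartedSpace E X] (S : Set X) (d : ℕ) : Prop :=
  ∀ x ∈ S, HasSliceChartAt E S d x

/-- The tangent space `T_x S`, as a subspace of `T_x X`: the vectors killed by the differentials
of all functions that are holomorphic near `x` and vanish on `S` near `x`. -/
noncomputable def tangentSubspace (E : Type u) [NormedAddCommGroup E] [NormedSpace ℂ E]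
    {X : Type v} [TopologicalSpace X] [ChartedSpace E X] (S : Set X) (x : X) :
    Submodule ℂ (TangentSpace 𝓘(ℂ, E) x) :=
  ⨅ (f : X → ℂ) (_ : ContMDiffAt 𝓘(ℂ, E) 𝓘(ℂ, ℂ) ω f x)
    (_ : ∀ᶠ y in 𝓝 x, y ∈ S → f y = 0), (mfderiv 𝓘(ℂ, E) 𝓘(ℂ, ℂ) f x).ker

/-- The local ring `𝒪_{X,x}` of germs at `x` of holomorphic functions on `X`. -/
def holomorphicGerms (E : Type u) [NormedAddCommGroup E] [NormedSpace ℂ E]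
    {X : Type v} [TopologicalSpace X] [ChartedSpace E X] (x : X) :
    Subring (Filter.Germ (𝓝 x) ℂ) where
  carrier := {g | ∃ f : X → ℂ, ContMDiffAt 𝓘(ℂ, E) 𝓘(ℂ, ℂ) ω f x ∧ (f : Filter.Germ (𝓝 x) ℂ) = g}
  mul_mem' := by
    rintro _ _ ⟨f, hf, rfl⟩ ⟨g, hg, rfl⟩
    exact ⟨f * g, by simpa only [smul_eq_mul] using hf.smul hg, rfl⟩
  one_mem' := ⟨fun _ => 1, contMDiffAt_const, rfl⟩
  add_mem' := by
    rintro _ _ ⟨f, hf, rfl⟩ ⟨g, hg, rfl⟩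
    exact ⟨f + g, hf.add hg, rfl⟩
  zero_mem' := ⟨fun _ => 0, contMDiffAt_const, rfl⟩
  neg_mem' := by
    rintro _ ⟨f, hf, rfl⟩
    exact ⟨-f, hf.neg, rfl⟩

/-- The ideal `I_{S,x} ⊆ 𝒪_{X,x}` of the germs that vanish on `S`. It is the unit ideal when
`x` is not in the closure of `S`. -/
def vanishingIdeal (E : Type u) [NormedAddCommGroup E] [NormedSpace ℂ E]
    {X : Type v} [TopologicalSpace X] [ChartedSpace E X] (S : Set X) (x : X) :
    Ideal (holomorphicGerms E x) where
  carrier := {g | ∃ f : X → ℂ, (f : Filter.Germ (𝓝 x) ℂ) = g ∧ ∀ᶠ y in 𝓝 x, y ∈ S → f y = 0}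
  add_mem' := by
    rintro ⟨_, _⟩ ⟨_, _⟩ ⟨f, rfl, hf⟩ ⟨g, rfl, hg⟩
    refine ⟨f + g, rfl, ?_⟩
    filter_upwards [hf, hg] with y h1 h2 hy
    simp [h1 hy, h2 hy]
  zero_mem' := ⟨fun _ => 0, rfl, by simp⟩
  smul_mem' := by
    rintro ⟨_, c, hc, rfl⟩ ⟨_, _⟩ ⟨f, rfl, hf⟩
    refine ⟨c * f, rfl, ?_⟩
    filter_upwards [hf] with y h1 hy
    simp [h1 hy]

/-- Inside the open set `U`, the submanifold `W` (with its reduced structure) is the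
scheme-theoretic intersection of `A` and `B`: it is their intersection as a set, and its ideal
sheaf on `U` is the sum of the ideal sheaves of `A` and `B`. -/
def IsSchemeTheoreticInter (E : Type u) [NormedAddCommGroup E] [NormedSpace ℂ E]
    {X : Type v} [TopologicalSpace X] [ChartedSpace E X] (U W A B : Set X) : Prop :=
  W ∩ U = A ∩ B ∩ U ∧
    ∀ x ∈ U, vanishingIdeal E W x = vanishingIdeal E A x ⊔ vanishingIdeal E B x

end ComplexManifold

/-! ### Dimension of finitely generated domains and rank of differentials -/

section DimensionOfAlgebras

open TensorProduct

/-! In both settings `Y` is cut out by a minimal choice of equations of `S`: as few as suffice to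
cut `W` out of `T` near `w`.

Varieties. Locally `X = Spec A`, `S = V(I)`, `T = V(J)`, `W = V(I + J)`. Let `P` be the local ring
at `w`, with residue field `κ`, and put `B = P/J`, `C = P/(I + J)`. The kernel of `B → C` is
generated by images of elements of `I`. By Nakayama, those `x₁, …, x_r ∈ I` that give a basis of its
fibre over `κ` already generate it. As `C` is smooth, the conormal map from this fibre to `κ ⊗ Ω_B`
is injective, so the `dxᵢ` are independent in `κ ⊗ Ω_B`, hence in `κ ⊗ Ω_P`
(`exists_linearIndependent_of_sup`). With `K = (x₁, …, x_r)` the Jacobian criterion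
(`formallySmooth_of_linearIndependent`) makes `Y = V(K)` smooth at `w`. Moreover `K ≤ I` gives `S ⊆
Y`, and `K + J = I + J` holds in `P`. Finally `dim X - dim Y = r = dim T - dim W`, dimensions being
fibre ranks of differentials. Everything spreads out to a basic open neighbourhood.

Manifolds. In a chart where `T` is a linear subspace `B`, choose finitely many functions `F`
vanishing on `S` whose differentials at `w` form a basis of the restrictions to `B` of all such
differentials. A right inverse `s` of `dF` with values in `B` gives the projection `P = id - s ∘ dF`
and the coordinate change `P + s ∘ F`, which preserves `B` and carries `F = 0` into `im P`
(`exists_straightening`). Take `Y` to be the preimage of `im P`. The tangent hypothesis shows that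
`W` has the full tangent space `im P ∩ B`, so `W = Y ∩ T` near `w`. For the ideals, write `f = (f -
f ∘ P) + f ∘ P`; the first summand vanishes on `Y`, and, when `f` vanishes on `W`, the second
vanishes on `T`. The dimension formula is that of `im P + B = E`. -/

/-- The Krull dimension is invariant under injective integral extensions. -/
theorem ringKrullDim_eq_of_isIntegral_of_injective {R S : Type*} [CommRing R] [CommRing S]
    [Algebra R S] [Algebra.IsIntegral R S] (h : Function.Injective (algebraMap R S)) :
    ringKrullDim R = ringKrullDim S := by
  apply le_antisymm
  · refine iSup_le fun l ↦ ?_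
    obtain ⟨Q, -, hQ, hQl⟩ := Ideal.exists_ideal_over_prime_of_isIntegral (S := S)
      (RelSeries.head l).asIdeal ⊥ (by
        rw [← RingHom.ker_eq_comap_bot, (RingHom.injective_iff_ker_eq_bot _).mp h]
        exact bot_le)
    have : Q.LiesOver (RelSeries.head l).asIdeal := ⟨hQl.symm⟩
    obtain ⟨L, hL, -⟩ := Ideal.exists_ltSeries_of_hasGoingUp l Q
    rw [← hL]
    exact Order.LTSeries.length_le_krullDim L
  · exact Order.krullDim_le_of_strictMono (PrimeSpectrum.comap (algebraMap R S))
      fun I J hIJ ↦ Ideal.IsIntegral.comap_lt_comap hIJ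

/-- The Krull dimension of a domain of finite type over a field is its transcendence degree. -/
theorem ringKrullDim_eq_of_trdeg_eq {k E : Type u} [Field k] [CommRing E] [IsDomain E]
    [Algebra k E] [Algebra.FiniteType k E] {n : ℕ} (h : Algebra.trdeg k E = n) :
    ringKrullDim E = n := by
  -- Noether normalization: both dimension and transcendence degree are those of a polynomial ring
  -- in `s` variables.
  obtain ⟨s, g, hg, hi⟩ := exists_integral_inj_algHom_of_fg k E
  algebraize [g.toRingHom]
  have : IsScalarTower k (MvPolynomial (Fin s) k) E := IsScalarTower.of_algebraMap_eq' (by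
    ext x; exact (g.commutes x).symm)
  have hinj : Function.Injective (algebraMap (MvPolynomial (Fin s) k) E) := hg
  have hf : FaithfulSMul (MvPolynomial (Fin s) k) E :=
    (faithfulSMul_iff_algebraMap_injective _ _).mpr hinj
  have hs : (s : Cardinal.{u}) = n := by
    have := trdeg_add_eq k (MvPolynomial (Fin s) k) (A := E)
    rw [trdeg_eq_zero (R := MvPolynomial (Fin s) k) (A := E), h] at this
    simpa using this
  rw [← ringKrullDim_eq_of_isIntegral_of_injective hinj,
    MvPolynomial.ringKrullDim_of_isNoetherianRing, ringKrullDim_eq_zero_of_field]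
  simp [Nat.cast_injective hs]

theorem Algebra.trdeg_eq_of_isLocalization {k : Type u} {A B : Type u} [Field k] [CommRing A]
    [CommRing B] [IsDomain A] [IsDomain B]
    [Algebra k A] [Algebra k B] [Algebra A B] [IsScalarTower k A B] (M : Submonoid A)
    [IsLocalization M B] :
    Algebra.trdeg k A = Algebra.trdeg k B := by
  have h0 : M ≤ nonZeroDivisors A := by
    intro m hm
    refine mem_nonZeroDivisors_of_ne_zero ?_
    rintro rfl
    exact (IsLocalization.map_units B (⟨0, hm⟩ : M)).ne_zero (map_zero _)
  have hinj := IsLocalization.injective B h0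
  have : FaithfulSMul A B := (faithfulSMul_iff_algebraMap_injective _ _).mpr hinj
  have : FaithfulSMul k A := (faithfulSMul_iff_algebraMap_injective _ _).mpr
    (algebraMap k A).injective
  have : Algebra.IsAlgebraic A B := IsLocalization.isAlgebraic B M
  rw [← trdeg_add_eq k A (A := B), trdeg_eq_zero (R := A) (A := B), add_zero]

/-- A domain that is étale over another one is algebraic over it. -/
theorem Algebra.Etale.isAlgebraic_of_isDomain {P E : Type u} [CommRing P] [IsDomain P]
    [CommRing E] [IsDomain E] [Algebra P E] [Algebra.Etale P E] :
    Function.Injective (algebraMap P E) ∧ Algebra.IsAlgebraic P E := by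
  have hinj : Function.Injective (algebraMap P E) := by
    rw [injective_iff_map_eq_zero]
    intro a ha
    by_contra h
    have := Module.Flat.isSMulRegular_of_nonZeroDivisors
      (M := E) (mem_nonZeroDivisors_of_ne_zero h)
    have h1 : (1 : E) = 0 := this (by simp [Algebra.smul_def, ha])
    exact one_ne_zero h1
  refine ⟨hinj, ?_⟩
  -- Over the fraction field the base change is unramified, hence finite. Flatness embeds `E` in `K
  -- ⊗ E`, and algebraicity descends.
  let K := FractionRing P
  have : Algebra.IsAlgebraic K (K ⊗[P] E) := by
    have := Algebra.FormallyUnramified.finite_of_free K (K ⊗[P] E)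
    infer_instance
  have h2 : Algebra.IsAlgebraic P (K ⊗[P] E) := by
    have : Algebra.IsAlgebraic P K := IsLocalization.isAlgebraic K (nonZeroDivisors P)
    exact Algebra.IsAlgebraic.trans P K _
  have hinj2 : Function.Injective
      (Algebra.TensorProduct.includeRight : E →ₐ[P] K ⊗[P] E) :=
    Algebra.TensorProduct.includeRight_injective (IsFractionRing.injective P K)
  exact Algebra.IsAlgebraic.of_injective _ hinj2

/-- The dimension of the fibre of the module of differentials is invariant under formally étale
algebras. -/
theorem finrank_tensor_kaehlerDifferential_of_formallyEtale (k S T κ : Type*) [CommRing k]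
    [CommRing S] [CommRing T] [Field κ] [Algebra k S] [Algebra k T] [Algebra S T]
    [IsScalarTower k S T] [Algebra T κ] [Algebra S κ] [IsScalarTower S T κ]
    [Algebra.FormallyEtale S T] :
    Module.finrank κ (κ ⊗[S] Ω[S⁄k]) = Module.finrank κ (κ ⊗[T] Ω[T⁄k]) :=
  LinearEquiv.finrank_eq ((AlgebraTensorModule.cancelBaseChange S T κ κ Ω[S⁄k]).symm.trans
    ((KaehlerDifferential.tensorKaehlerEquivOfFormallyEtale k S T).baseChange T κ _ _))

theorem finrank_tensor_kaehlerDifferential_mvPolynomial (k κ : Type*) [CommRing k] [Field κ]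
    (n : ℕ) [Algebra (MvPolynomial (Fin n) k) κ] :
    Module.finrank κ (κ ⊗[MvPolynomial (Fin n) k] Ω[MvPolynomial (Fin n) k⁄k]) = n := by
  rw [Module.finrank_eq_card_basis
    ((KaehlerDifferential.mvPolynomialBasis k (Fin n)).baseChange κ)]
  simp

/-- The dimension of a domain of finite type over a field is the dimension of the fibre of its
module of differentials at any smooth point. -/
theorem ringKrullDim_eq_finrank_tensor_kaehlerDifferential (k E κ : Type u) [Field k]
    [CommRing E] [IsDomain E] [Algebra k E] [Algebra.FiniteType k E] [Field κ] [Algebra E κ]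
    (q : Ideal E) [q.IsPrime] (hq : RingHom.ker (algebraMap E κ) = q)
    [Algebra.IsSmoothAt k q] :
    ringKrullDim E = Module.finrank κ (κ ⊗[E] Ω[E⁄k]) := by
  have : Algebra.FinitePresentation k E := Algebra.FinitePresentation.of_finiteType.mp inferInstance
  -- Near a smooth point `E` is étale over a polynomial ring in `n` variables; `n` is then both the
  -- transcendence degree and the fibre rank of the differentials.
  obtain ⟨h, hh, n, _, _, _⟩ :=
    Algebra.IsSmoothAt.exists_isStandardEtale_mvPolynomial (R := k) (p := q)
  have h0 : h ≠ 0 := fun h ↦ hh (h ▸ q.zero_mem)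
  have : IsDomain (Localization.Away h) :=
    IsLocalization.isDomain_localization (powers_le_nonZeroDivisors_of_noZeroDivisors h0)
  obtain ⟨hinj, halg⟩ := Algebra.Etale.isAlgebraic_of_isDomain
    (P := MvPolynomial (Fin n) k) (E := Localization.Away h)
  have hf : FaithfulSMul (MvPolynomial (Fin n) k) (Localization.Away h) :=
    (faithfulSMul_iff_algebraMap_injective _ _).mpr hinj
  have ht : Algebra.trdeg k E = n := by
    rw [Algebra.trdeg_eq_of_isLocalization (B := Localization.Away h) (Submonoid.powers h),
      ← trdeg_add_eq k (MvPolynomial (Fin n) k) (A := Localization.Away h),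
      trdeg_eq_zero (R := MvPolynomial (Fin n) k) (A := Localization.Away h)]
    simp
  rw [ringKrullDim_eq_of_trdeg_eq ht]
  have hu : IsUnit (algebraMap E κ h) := by
    rw [isUnit_iff_ne_zero, ne_eq, ← RingHom.mem_ker, hq]
    exact hh
  let φ : Localization.Away h →+* κ := IsLocalization.Away.lift h hu
  let : Algebra (Localization.Away h) κ := φ.toAlgebra
  let : Algebra (MvPolynomial (Fin n) k) κ :=
    (φ.comp (algebraMap (MvPolynomial (Fin n) k) (Localization.Away h))).toAlgebra
  have : IsScalarTower (MvPolynomial (Fin n) k) (Localization.Away h) κ :=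
    IsScalarTower.of_algebraMap_eq' rfl
  have : IsScalarTower E (Localization.Away h) κ :=
    IsScalarTower.of_algebraMap_eq' (by ext x; simp [φ, RingHom.algebraMap_toAlgebra])
  have : Algebra.FormallyEtale E (Localization.Away h) :=
    Algebra.FormallyEtale.of_isLocalization (Submonoid.powers h)
  rw [finrank_tensor_kaehlerDifferential_of_formallyEtale k E (Localization.Away h) κ,
    ← finrank_tensor_kaehlerDifferential_of_formallyEtale k (MvPolynomial (Fin n) k)
      (Localization.Away h) κ, finrank_tensor_kaehlerDifferential_mvPolynomial]

end DimensionOfAlgebras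

/-! ### Smooth algebras over a field are locally domains -/

section SmoothAlgebrasAreLocallyDomains

open TensorProduct

/-- The criterion speaks of elements of `A` only, so it compares localizations at different elements
without maps between them. -/
theorem isDomain_away_iff {A A' : Type*} [CommRing A] [CommRing A'] [Algebra A A'] (g : A)
    [IsLocalization.Away g A'] :
    IsDomain A' ↔ ¬ IsNilpotent g ∧
      ∀ a b : A, a * b = 0 → ∃ n : ℕ, g ^ n * a = 0 ∨ g ^ n * b = 0 := by
  have key (a : A) : algebraMap A A' a = 0 ↔ ∃ n : ℕ, g ^ n * a = 0 := by
    rw [IsLocalization.map_eq_zero_iff (Submonoid.powers g)]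
    constructor
    · rintro ⟨⟨_, n, rfl⟩, h⟩
      exact ⟨n, h⟩
    · rintro ⟨n, h⟩
      exact ⟨⟨_, n, rfl⟩, h⟩
  have hn : Nontrivial A' ↔ ¬ IsNilpotent g := by
    rw [← not_subsingleton_iff_nontrivial,
      IsLocalization.subsingleton_iff (M := Submonoid.powers g) (S := A')]
    rfl
  constructor
  · intro h
    refine ⟨hn.mp inferInstance, fun a b hab ↦ ?_⟩
    have : algebraMap A A' a * algebraMap A A' b = 0 := by rw [← map_mul, hab, map_zero]
    rcases mul_eq_zero.mp this with h | h
    · obtain ⟨n, hn⟩ := (key a).mp h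
      exact ⟨n, .inl hn⟩
    · obtain ⟨n, hn⟩ := (key b).mp h
      exact ⟨n, .inr hn⟩
  · rintro ⟨h1, h2⟩
    have := hn.mpr h1
    refine @NoZeroDivisors.to_isDomain A' _ this ⟨fun {x y} hxy ↦ ?_⟩
    obtain ⟨a, s, rfl⟩ := IsLocalization.exists_mk'_eq (Submonoid.powers g) x
    obtain ⟨b, t, rfl⟩ := IsLocalization.exists_mk'_eq (Submonoid.powers g) y
    rw [← IsLocalization.mk'_mul, IsLocalization.mk'_eq_zero_iff] at hxy
    obtain ⟨⟨_, n, rfl⟩, hm⟩ := hxy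
    simp only [IsLocalization.mk'_eq_zero_iff]
    obtain ⟨m, h | h⟩ := h2 (g ^ n * a) b (by rw [mul_assoc]; exact hm)
    · exact .inl ⟨⟨_, m + n, rfl⟩, by simpa [pow_add, mul_assoc] using h⟩
    · exact .inr ⟨⟨_, m, rfl⟩, h⟩

/-- If a localization away from `g` is a domain, so is any further localization. -/
theorem isDomain_away_of_dvd {A A₁ A₂ : Type*} [CommRing A] [CommRing A₁] [Algebra A A₁]
    [CommRing A₂] [Algebra A A₂] (g h : A) [IsLocalization.Away g A₁] [IsLocalization.Away h A₂]
    (hg : g ∣ h) (hh : ¬ IsNilpotent h) [IsDomain A₁] : IsDomain A₂ := by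
  obtain ⟨c, rfl⟩ := hg
  refine (isDomain_away_iff (g * c)).mpr ⟨hh, fun a b hab ↦ ?_⟩
  obtain ⟨n, hn | hn⟩ := ((isDomain_away_iff (A' := A₁) g).mp inferInstance).2 a b hab
  · exact ⟨n, .inl (by rw [mul_pow, mul_right_comm, hn, zero_mul])⟩
  · exact ⟨n, .inr (by rw [mul_pow, mul_right_comm, hn, zero_mul])⟩

/-- An étale algebra over a normal domain has a partition of unity by idempotents that cut out
domains. -/
theorem Algebra.Etale.exists_notMem_forall_mul_eq_zero {P E : Type u} [CommRing P] [IsDomain P]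
    [IsIntegrallyClosed P] [CommRing E] [Algebra P E] [Algebra.Etale P E]
    (q : Ideal E) [q.IsPrime] :
    ∃ e ∉ q, ∀ a b : E, a * b = 0 → e * a = 0 ∨ e * b = 0 := by
  let K := FractionRing P
  let F := E ⊗[P] K
  have hinj : Function.Injective (algebraMap E F) :=
    Algebra.TensorProduct.includeLeft_injective (S := E) (IsFractionRing.injective P K)
  -- Integral closure commutes with smooth base change and `P` is normal, so `E` is integrally
  -- closed in `E ⊗ K`.
  have hint (x : F) (hx : IsIntegral E x) : ∃ y, algebraMap E F y = x := by
    obtain ⟨z, hz⟩ := (TensorProduct.toIntegralClosure_bijective_of_smooth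
      (R := P) (S := E) (B := K)).2 ⟨x, hx⟩
    have : x = (Algebra.TensorProduct.map (.id E E) (integralClosure P K).val) z :=
      congrArg Subtype.val hz.symm
    rw [this]
    clear this hz
    induction z with
    | zero => exact ⟨0, by simp⟩
    | add z w hz hw =>
      obtain ⟨a, ha⟩ := hz
      obtain ⟨b, hb⟩ := hw
      exact ⟨a + b, by rw [map_add, map_add, ha, hb]⟩
    | tmul s y =>
      obtain ⟨p, hp⟩ := IsIntegrallyClosed.isIntegral_iff.mp y.2
      refine ⟨p • s, ?_⟩
      simp only [Algebra.TensorProduct.map_tmul, AlgHom.coe_id, id_eq, Subalgebra.coe_val, ← hp]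
      rw [Algebra.TensorProduct.algebraMap_apply, Algebra.algebraMap_self, RingHom.id_apply,
        TensorProduct.smul_tmul, Algebra.smul_def, mul_one]
  -- An étale algebra over the field `K` is a finite product of fields. Its idempotents are roots of
  -- `X² - X`, hence integral, hence come from `E`; they sum to `1`, so one of them is outside `q`.
  obtain ⟨I, hI, Ai, _, _, φ, -⟩ :=
    (Algebra.Etale.iff_exists_algEquiv_prod K (K ⊗[P] E)).mp inferInstance
  let ψ : F ≃+* Π i, Ai i :=
    (Algebra.TensorProduct.comm P E K).toRingEquiv.trans φ.toRingEquiv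
  classical
  have := Fintype.ofFinite I
  have hidem (i : I) : ∃ y, algebraMap E F y = ψ.symm (Pi.single i 1) := by
    refine hint _ ⟨Polynomial.X ^ 2 - Polynomial.X, ?_, ?_⟩
    · exact Polynomial.monic_X_pow_sub (Polynomial.degree_X_le.trans_lt (by norm_num))
    · rw [Polynomial.eval₂_sub, Polynomial.eval₂_X_pow, Polynomial.eval₂_X, pow_two, ← map_mul,
        ← Pi.single_mul, mul_one, sub_self]
  choose e he using hidem
  have hsum : ∑ i, e i = 1 := by
    apply hinj
    rw [map_sum, map_one]
    simp_rw [he]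
    rw [← map_sum, Finset.univ_sum_single (fun _ ↦ 1)]
    exact map_one _
  obtain ⟨i, hi⟩ : ∃ i, e i ∉ q := by
    by_contra! h
    exact (Ideal.ne_top_iff_one q).mp ‹q.IsPrime›.ne_top (hsum ▸ q.sum_mem fun i _ ↦ h i)
  have hz (a : E) : e i * a = 0 ↔ ψ (algebraMap E F a) i = 0 := by
    rw [← map_eq_zero_iff _ hinj, map_mul, he, ← map_eq_zero_iff ψ ψ.injective, map_mul,
      RingEquiv.apply_symm_apply]
    refine ⟨fun h ↦ by simpa using congrFun h i, fun h ↦ funext fun j ↦ ?_⟩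
    rcases eq_or_ne j i with rfl | hj
    · simpa using h
    · simp [hj]
  refine ⟨e i, hi, fun a b hab ↦ ?_⟩
  rw [hz, hz, ← mul_eq_zero, ← Pi.mul_apply, ← map_mul, ← map_mul, hab]
  simp

/-- A smooth algebra over a field is locally a domain. -/
theorem Algebra.IsSmoothAt.exists_notMem_isDomain (k : Type u) {E : Type u} [Field k] [CommRing E]
    [Algebra k E] [Algebra.FiniteType k E] (q : Ideal E) [q.IsPrime] [Algebra.IsSmoothAt k q] :
    ∃ g ∉ q, IsDomain (Localization.Away g) := by
  have : Algebra.FinitePresentation k E := Algebra.FinitePresentation.of_finiteType.mp inferInstance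
  obtain ⟨h, hh, n, _, _, _⟩ :=
    Algebra.IsSmoothAt.exists_isStandardEtale_mvPolynomial (R := k) (p := q)
  let E' := Localization.Away h
  have hd : Disjoint (Submonoid.powers h : Set E) q :=
    (Ideal.disjoint_powers_iff_notMem_of_isPrime _).mpr hh
  have : (q.map (algebraMap E E')).IsPrime :=
    IsLocalization.isPrime_of_isPrime_disjoint (Submonoid.powers h) _ _ ‹_› hd
  have hc : (q.map (algebraMap E E')).comap (algebraMap E E') = q :=
    IsLocalization.under_map_of_isPrime_disjoint (Submonoid.powers h) _ ‹_› hd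
  obtain ⟨ε, hε, H⟩ := Algebra.Etale.exists_notMem_forall_mul_eq_zero
    (P := MvPolynomial (Fin n) k) (q.map (algebraMap E E'))
  -- `ε` lives in `E[1/h]`; its numerator `e` is also outside `q`, and inverting `e * h` in `E` has
  -- the desired effect.
  obtain ⟨e, ⟨_, m, rfl⟩, rfl⟩ := IsLocalization.exists_mk'_eq (Submonoid.powers h) ε
  have he : e ∉ q := fun he ↦ hε (by
    rw [IsLocalization.mk'_mem_iff]
    exact Ideal.mem_map_of_mem _ he)
  have heh : e * h ∉ q := ‹q.IsPrime›.mul_notMem he hh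
  refine ⟨e * h, heh, (isDomain_away_iff (e * h)).mpr ⟨?_, fun a b hab ↦ ?_⟩⟩
  · rintro ⟨n, hn⟩
    exact heh (‹q.IsPrime›.mem_of_pow_mem n (hn ▸ q.zero_mem))
  · have key (a : E) (ha : IsLocalization.mk' E' e (⟨_, m, rfl⟩ : Submonoid.powers h) *
        algebraMap E E' a = 0) : ∃ n : ℕ, (e * h) ^ n * a = 0 := by
      rw [mul_comm, IsLocalization.mul_mk'_eq_mk'_of_mul, IsLocalization.mk'_eq_zero_iff] at ha
      obtain ⟨⟨_, n, rfl⟩, hn⟩ := ha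
      refine ⟨n + 1, ?_⟩
      linear_combination (e ^ n * h) * hn
    rcases H (algebraMap E E' a) (algebraMap E E' b) (by rw [← map_mul, hab, map_zero]) with h | h
    · exact (key a h).imp fun n hn ↦ .inl hn
    · exact (key b h).imp fun n hn ↦ .inr hn

end SmoothAlgebrasAreLocallyDomains

/-! ### The conormal sequence and the Jacobian criterion -/

section JacobianCriterion

open TensorProduct KaehlerDifferential

/-- `κ ⊗ L` is spanned by the pure tensors `1 ⊗ x` with `x` in a generating set of `L`. -/
theorem span_one_tmul_eq_top {P κ L : Type*} [CommRing P] [Field κ] [Algebra P κ]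
    [AddCommGroup L] [Module P L] (s : Set L) (hs : Submodule.span P s = ⊤) :
    Submodule.span κ ((fun x ↦ (1 : κ) ⊗ₜ[P] x) '' s) = ⊤ := by
  have := Submodule.baseChange_span κ s (R := P)
  rw [hs, Submodule.baseChange_top] at this
  exact this.symm

/-- Right exactness of `κ ⊗ -`, phrased with pure tensors so that it feeds span induction. -/
theorem mem_span_of_baseChange_eq_zero {D κ M N : Type*} [CommRing D] [Field κ] [Algebra D κ]
    [AddCommGroup M] [Module D M] [AddCommGroup N] [Module D N] {f : M →ₗ[D] N}
    (hf : Function.Surjective f) (y : κ ⊗[D] M) (hy : f.baseChange κ y = 0) :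
    y ∈ Submodule.span κ {z | ∃ (c : κ) (m : M), f m = 0 ∧ z = c ⊗ₜ m} := by
  obtain ⟨z, rfl⟩ := (lTensor_exact κ (LinearMap.exact_subtype_ker_map f) hf y).mp hy
  clear hy
  induction z with
  | zero => simp
  | add x y hx hy =>
    rw [map_add]
    exact add_mem hx hy
  | tmul c m => exact Submodule.subset_span ⟨c, m.1, m.2, rfl⟩

/-- The fibre of the conormal sequence of a surjection of algebras is right exact. -/
theorem exists_ker_eq_range_cotangentComplexBaseChange (k P D κ : Type*) [CommRing k] [CommRing P]
    [CommRing D] [Field κ] [Algebra k P] [Algebra k D] [Algebra P D] [IsScalarTower k P D]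
    [Algebra D κ] [Algebra P κ] [IsScalarTower P D κ] (hD : Function.Surjective (algebraMap P D)) :
    ∃ π : κ ⊗[P] Ω[P⁄k] →ₗ[κ] κ ⊗[D] Ω[D⁄k], Function.Surjective π ∧
      LinearMap.ker π = LinearMap.range (cotangentComplexBaseChange k D P κ) ∧
      ∀ x : P, π (1 ⊗ₜ KaehlerDifferential.D k P x) =
        1 ⊗ₜ KaehlerDifferential.D k D (algebraMap P D x) := by
  let e : κ ⊗[D] (D ⊗[P] Ω[P⁄k]) ≃ₗ[κ] κ ⊗[P] Ω[P⁄k] :=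
    AlgebraTensorModule.cancelBaseChange P D κ κ Ω[P⁄k]
  let ρ : κ ⊗[D] (D ⊗[P] Ω[P⁄k]) →ₗ[κ] κ ⊗[D] Ω[D⁄k] :=
    (mapBaseChange k P D).baseChange κ
  have hρ : Function.Surjective ρ := LinearMap.lTensor_surjective κ (mapBaseChange_surjective k P D hD)
  have hval (x : P) : (ρ ∘ₗ e.symm.toLinearMap) (1 ⊗ₜ KaehlerDifferential.D k P x) =
      1 ⊗ₜ KaehlerDifferential.D k D (algebraMap P D x) := by
    simp [ρ, e]
  refine ⟨ρ ∘ₗ e.symm.toLinearMap, hρ.comp e.symm.surjective, le_antisymm ?_ ?_, hval⟩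
  · intro x hx
    obtain ⟨y, rfl⟩ := e.surjective x
    have hy : ρ y = 0 := by simpa using hx
    refine Submodule.span_induction (p := fun y _ ↦ e y ∈ _) ?_ ?_ ?_ ?_
      (mem_span_of_baseChange_eq_zero (mapBaseChange_surjective k P D hD) y hy)
    · rintro _ ⟨c, m, hm, rfl⟩
      obtain ⟨a, ha⟩ := (exact_kerCotangentToTensor_mapBaseChange k P D hD m).mp hm
      obtain ⟨a, rfl⟩ := Ideal.toCotangent_surjective _ a
      refine ⟨c ⊗ₜ a, ?_⟩
      rw [← ha, kerCotangentToTensor_toCotangent, cotangentComplexBaseChange_tmul,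
        kerToTensor_apply]
      simp [e, smul_tmul']
    · simp
    · intro x y _ _ hx hy
      rw [map_add]
      exact add_mem hx hy
    · intro c x _ hx
      rw [map_smul]
      exact Submodule.smul_mem _ c hx
  · rintro _ ⟨x, rfl⟩
    rw [LinearMap.mem_ker]
    induction x with
    | zero => simp
    | add x y hx hy => rw [map_add, map_add, hx, hy, add_zero]
    | tmul c x =>
      rw [cotangentComplexBaseChange_tmul, map_smul, kerToTensor_apply, hval,
        RingHom.mem_ker.mp x.2, map_zero, tmul_zero, smul_zero]

theorem cotangentComplexBaseChange_one_tmul (k P D κ : Type*) [CommRing k] [CommRing P]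
    [CommRing D] [Field κ] [Algebra k P] [Algebra P D]
    [Algebra D κ] [Algebra P κ] [IsScalarTower P D κ] (x : RingHom.ker (algebraMap P D)) :
    cotangentComplexBaseChange k D P κ (1 ⊗ₜ x) = 1 ⊗ₜ KaehlerDifferential.D k P x.1 := by
  rw [cotangentComplexBaseChange_tmul, kerToTensor_apply, one_smul]

/-- The quotient of a smooth local algebra by elements with independent differentials is smooth,
and the fibre of its module of differentials drops by the number of these elements. -/
theorem formallySmooth_of_linearIndependent (k P D κ : Type*) [CommRing k] [CommRing P]
    [CommRing D] [Field κ] [Algebra k P] [Algebra k D] [Algebra P D] [IsScalarTower k P D]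
    [Algebra D κ] [Algebra P κ] [IsScalarTower P D κ] (hD : Function.Surjective (algebraMap P D))
    [IsLocalRing D] (hκ : IsLocalRing.maximalIdeal D ≤ RingHom.ker (algebraMap D κ))
    [Algebra.FormallySmooth k P] [Module.Free P Ω[P⁄k]] [Module.Finite P Ω[P⁄k]]
    {r : ℕ} (f : Fin r → P) (hf : RingHom.ker (algebraMap P D) = Ideal.span (Set.range f))
    (hli : LinearIndependent κ fun i ↦ (1 : κ) ⊗ₜ[P] KaehlerDifferential.D k P (f i)) :
    Algebra.FormallySmooth k D ∧
      Module.finrank κ (κ ⊗[P] Ω[P⁄k]) = r + Module.finrank κ (κ ⊗[D] Ω[D⁄k]) := by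
  have hmem (i : Fin r) : f i ∈ RingHom.ker (algebraMap P D) :=
    hf ▸ Ideal.subset_span (Set.mem_range_self i)
  let f' (i : Fin r) : RingHom.ker (algebraMap P D) := ⟨f i, hmem i⟩
  have hspan : Submodule.span P (Set.range f') = ⊤ := by
    apply Submodule.map_injective_of_injective (f := Submodule.subtype _) Subtype.val_injective
    rw [Submodule.map_span, Submodule.map_top, Submodule.range_subtype, ← Set.range_comp]
    exact hf.symm
  have hspan' : Submodule.span κ (Set.range fun i ↦ (1 : κ) ⊗ₜ[P] f' i) = ⊤ := by
    rw [← span_one_tmul_eq_top _ hspan, ← Set.range_comp]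
    rfl
  let c := cotangentComplexBaseChange k D P κ
  have hc (i : Fin r) : c (1 ⊗ₜ f' i) = 1 ⊗ₜ KaehlerDifferential.D k P (f i) :=
    cotangentComplexBaseChange_one_tmul k P D κ _
  let b : Module.Basis (Fin r) κ (κ ⊗[P] RingHom.ker (algebraMap P D)) :=
    Module.Basis.mk (v := fun i ↦ (1 : κ) ⊗ₜ[P] f' i)
      (LinearIndependent.of_comp c (by simpa only [Function.comp_def, hc] using hli)) hspan'.ge
  -- The conormal map `c` sends the basis `b` to the independent family of differentials, so it is
  -- injective, which is the criterion for smoothness of the quotient.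
  have hinj : Function.Injective c := by
    have : (c : _ → κ ⊗[P] Ω[P⁄k]) = Finsupp.linearCombination κ
        (fun i ↦ (1 : κ) ⊗ₜ[P] KaehlerDifferential.D k P (f i)) ∘ b.repr := by
      rw [← LinearEquiv.coe_coe, ← LinearMap.coe_comp]
      congr 1
      refine b.ext fun i ↦ ?_
      simp only [Function.comp_apply, LinearMap.coe_comp, LinearEquiv.coe_coe,
        Module.Basis.repr_self, Finsupp.linearCombination_single, one_smul, ← hc]
      simp [b]
    rw [this]
    exact Function.Injective.comp hli b.repr.injective
  refine ⟨(Algebra.FormallySmooth.iff_injective_cotangentComplexBaseChange P κ hD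
    (hf ▸ Submodule.fg_span (Set.finite_range f)) hκ).mpr hinj, ?_⟩
  obtain ⟨π, hπ, hker, -⟩ := exists_ker_eq_range_cotangentComplexBaseChange k P D κ hD
  rw [← LinearMap.finrank_range_add_finrank_ker π, hker, LinearMap.range_eq_top.mpr hπ,
    finrank_top, LinearMap.finrank_range_of_inj hinj, Module.finrank_eq_card_basis b,
    Fintype.card_fin, add_comm]

/-- A finite module over a local ring whose fibre vanishes is zero. -/
theorem subsingleton_of_subsingleton_tensor {B κ M : Type*} [CommRing B] [IsLocalRing B] [Field κ]
    [Algebra B κ] (hκ : Function.Surjective (algebraMap B κ)) [AddCommGroup M] [Module B M]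
    [Module.Finite B M] [h : Subsingleton (κ ⊗[B] M)] : Subsingleton M := by
  have hm : RingHom.ker (algebraMap B κ) = IsLocalRing.maximalIdeal B :=
    IsLocalRing.eq_maximalIdeal (RingHom.ker_isMaximal_of_surjective _ hκ)
  let e : (B ⧸ IsLocalRing.maximalIdeal B) ≃ₗ[B] κ :=
    (Submodule.quotEquivOfEq _ _ hm.symm).trans
      (LinearMap.quotKerEquivOfSurjective (Algebra.linearMap B κ) hκ)
  have : Subsingleton (IsLocalRing.ResidueField B ⊗[B] M) :=
    (TensorProduct.congr e (LinearEquiv.refl B M)).toEquiv.subsingleton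
  exact IsLocalRing.subsingleton_tensorProduct.mp this

/-- A subfamily of a spanning family of a finite-dimensional vector space is a basis. -/
theorem exists_basis_of_span_range_eq_top {K V ι : Type*} [Field K] [AddCommGroup V] [Module K V]
    [Module.Finite K V] (v : ι → V) (hv : Submodule.span K (Set.range v) = ⊤) :
    ∃ (r : ℕ) (s : Fin r → ι) (b : Module.Basis (Fin r) K V), ∀ i, b i = v (s i) := by
  obtain ⟨f, hf, hspan, hli⟩ := Submodule.exists_fun_fin_finrank_span_eq K (Set.range v)
  choose s hs using hf
  exact ⟨_, s, Module.Basis.mk hli (by rw [hspan, hv]), fun i ↦ by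
    rw [Module.Basis.mk_apply, hs]⟩

/-- The ideal of a smooth quotient of a smooth local algebra is generated by elements with
independent differentials, which can be picked from any family of generators. -/
theorem exists_linearIndependent_of_formallySmooth (k B C κ : Type*) [CommRing k]
    [CommRing B] [IsNoetherianRing B] [IsLocalRing B] [CommRing C] [IsLocalRing C] [Field κ]
    [Algebra k B] [Algebra k C] [Algebra B C] [IsScalarTower k B C] [Algebra B κ] [Algebra C κ]
    [IsScalarTower B C κ] (hBκ : Function.Surjective (algebraMap B κ))
    (hBC : Function.Surjective (algebraMap B C))
    (hκ : IsLocalRing.maximalIdeal C ≤ RingHom.ker (algebraMap C κ))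
    [Algebra.FormallySmooth k B] [Module.Free B Ω[B⁄k]] [Module.Finite B Ω[B⁄k]]
    [Algebra.FormallySmooth k C] {ι : Type*} (x : ι → B)
    (hx : RingHom.ker (algebraMap B C) = Ideal.span (Set.range x)) :
    ∃ (r : ℕ) (s : Fin r → ι), RingHom.ker (algebraMap B C) = Ideal.span (Set.range (x ∘ s)) ∧
      LinearIndependent κ (fun i ↦ (1 : κ) ⊗ₜ[B] KaehlerDifferential.D k B (x (s i))) ∧
      Module.finrank κ (κ ⊗[B] Ω[B⁄k]) = r + Module.finrank κ (κ ⊗[C] Ω[C⁄k]) := by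
  have hmem (i : ι) : x i ∈ RingHom.ker (algebraMap B C) :=
    hx ▸ Ideal.subset_span (Set.mem_range_self i)
  let φ (i : ι) : RingHom.ker (algebraMap B C) := ⟨x i, hmem i⟩
  have hφ : Submodule.span B (Set.range φ) = ⊤ := by
    apply Submodule.map_injective_of_injective (f := Submodule.subtype _) Subtype.val_injective
    rw [Submodule.map_span, Submodule.map_top, Submodule.range_subtype, ← Set.range_comp]
    exact hx.symm
  have hspan := span_one_tmul_eq_top (κ := κ) _ hφ
  rw [← Set.range_comp] at hspan
  have hfg : (RingHom.ker (algebraMap B C)).FG := IsNoetherian.noetherian _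
  have : Module.Finite B (RingHom.ker (algebraMap B C)) := Module.Finite.of_fg hfg
  -- The basis of the fibre of the ideal is picked among the classes of the given generators, so
  -- that lifts remain in the family `x`.
  obtain ⟨r, s, b, hb'⟩ := exists_basis_of_span_range_eq_top _ hspan
  have hb (i : Fin r) : b i = 1 ⊗ₜ φ (s i) := hb' i
  let c := cotangentComplexBaseChange k C B κ
  have hinj : Function.Injective c :=
    (Algebra.FormallySmooth.iff_injective_cotangentComplexBaseChange B κ hBC hfg hκ).mp
      inferInstance
  have hc (i : ι) : c (1 ⊗ₜ φ i) = 1 ⊗ₜ KaehlerDifferential.D k B (x i) :=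
    cotangentComplexBaseChange_one_tmul k B C κ _
  refine ⟨r, s, ?_, ?_, ?_⟩
  -- Nakayama: the quotient by the span `N` of the picked generators has zero fibre.
  · let N : Submodule B (RingHom.ker (algebraMap B C)) := Submodule.span B (Set.range (φ ∘ s))
    have hN (i : Fin r) : φ (s i) ∈ N := Submodule.subset_span ⟨i, rfl⟩
    have hsub : Subsingleton (κ ⊗[B] (RingHom.ker (algebraMap B C) ⧸ N)) := by
      have h0 : N.mkQ.baseChange κ = 0 := by
        refine b.ext fun i ↦ ?_
        rw [hb, LinearMap.baseChange_tmul, Submodule.mkQ_apply,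
          (Submodule.Quotient.mk_eq_zero N).mpr (hN i), tmul_zero,
          LinearMap.zero_apply]
      refine subsingleton_of_forall_eq 0 fun y ↦ ?_
      obtain ⟨z, rfl⟩ := LinearMap.lTensor_surjective κ N.mkQ_surjective y
      exact LinearMap.congr_fun h0 z
    have := subsingleton_of_subsingleton_tensor (M := RingHom.ker (algebraMap B C) ⧸ N) hBκ
    have hN : N = ⊤ := Submodule.Quotient.subsingleton_iff.mp this
    have := congrArg (Submodule.map (Submodule.subtype _)) hN
    rw [Submodule.map_span, Submodule.map_top, Submodule.range_subtype, ← Set.range_comp] at this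
    exact this.symm
  · have : (fun i ↦ (1 : κ) ⊗ₜ[B] KaehlerDifferential.D k B (x (s i))) = c ∘ b := by
      ext i
      rw [Function.comp_apply, hb, hc]
    rw [this]
    exact b.linearIndependent.map' c (LinearMap.ker_eq_bot.mpr hinj)
  · obtain ⟨π, hπ, hker, -⟩ := exists_ker_eq_range_cotangentComplexBaseChange k B C κ hBC
    rw [← LinearMap.finrank_range_add_finrank_ker π, hker, LinearMap.range_eq_top.mpr hπ,
      finrank_top, LinearMap.finrank_range_of_inj hinj, Module.finrank_eq_card_basis b,
      Fintype.card_fin, add_comm]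

end JacobianCriterion

/-! ### Equations of `S` that cut `W` out of `T`; localizing quotients -/

section TransverseEquations

open TensorProduct KaehlerDifferential

/-- Let `P` be a local ring, `I` and `J` ideals such that `B = P ⧸ J` and `C = P ⧸ (I + J)` are
smooth. Then `C` is cut out in `B` by elements of `I` with independent differentials. -/
theorem exists_linearIndependent_of_sup (k P B C κ : Type*) [CommRing k] [CommRing P]
    [IsNoetherianRing P] [CommRing B] [CommRing C] [Field κ] [Algebra k P] [Algebra k B]
    [Algebra k C] [Algebra P B] [Algebra P C] [Algebra B C] [IsScalarTower k P B]
    [IsScalarTower k B C] [IsScalarTower P B C] [Algebra P κ] [Algebra B κ] [Algebra C κ]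
    [IsScalarTower P B κ] [IsScalarTower B C κ]
    (hP : Function.Surjective (algebraMap P κ))
    (hB : Function.Surjective (algebraMap P B)) (hC : Function.Surjective (algebraMap P C))
    [IsLocalRing B] [IsLocalRing C]
    (hκ : IsLocalRing.maximalIdeal C ≤ RingHom.ker (algebraMap C κ))
    (I J : Ideal P) (hJ : RingHom.ker (algebraMap P B) = J)
    (hIJ : RingHom.ker (algebraMap P C) = I ⊔ J)
    [Algebra.FormallySmooth k B] [Module.Free B Ω[B⁄k]] [Module.Finite B Ω[B⁄k]]
    [Algebra.FormallySmooth k C] {ι : Type*} (x : ι → P) (hx : I = Ideal.span (Set.range x)) :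
    ∃ (r : ℕ) (s : Fin r → ι), I ⊔ J = Ideal.span (Set.range (x ∘ s)) ⊔ J ∧
      LinearIndependent κ (fun i ↦ (1 : κ) ⊗ₜ[P] KaehlerDifferential.D k P (x (s i))) ∧
      Module.finrank κ (κ ⊗[B] Ω[B⁄k]) = r + Module.finrank κ (κ ⊗[C] Ω[C⁄k]) := by
  have : IsNoetherianRing B := isNoetherianRing_of_surjective P B _ hB
  have hBC : Function.Surjective (algebraMap B C) := by
    refine .of_comp (g := algebraMap P B) ?_
    rwa [← RingHom.coe_comp, ← IsScalarTower.algebraMap_eq]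
  have hBκ : Function.Surjective (algebraMap B κ) := by
    refine .of_comp (g := algebraMap P B) ?_
    rwa [← RingHom.coe_comp, ← IsScalarTower.algebraMap_eq]
  have hcomap : (RingHom.ker (algebraMap B C)).comap (algebraMap P B) = I ⊔ J := by
    rw [RingHom.comap_ker, ← IsScalarTower.algebraMap_eq, hIJ]
  have hcomap' (L : Ideal P) : (L.map (algebraMap P B)).comap (algebraMap P B) = L ⊔ J := by
    rw [Ideal.comap_map_of_surjective' _ hB, hJ]
  have hxB : RingHom.ker (algebraMap B C) = Ideal.span (Set.range (algebraMap P B ∘ x)) := by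
    rw [Set.range_comp, ← Ideal.map_span, ← hx]
    apply Ideal.comap_injective_of_surjective _ hB
    rw [hcomap, hcomap']
  obtain ⟨r, s, hs, hli, hr⟩ := exists_linearIndependent_of_formallySmooth k B C κ hBκ hBC hκ _ hxB
  refine ⟨r, s, ?_, ?_, hr⟩
  · rw [← hcomap, hs, Function.comp_assoc, Set.range_comp, ← Ideal.map_span, hcomap']
  -- Independence in `κ ⊗ Ω_B` lifts along the map from `κ ⊗ Ω_P`, which respects differentials.
  · obtain ⟨π, -, -, hπ⟩ := exists_ker_eq_range_cotangentComplexBaseChange k P B κ hB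
    refine LinearIndependent.of_comp π ?_
    convert hli with i
    exact hπ _

/-- The localization of a quotient. -/
theorem isLocalization_quotient {A A' : Type*} [CommRing A] [CommRing A'] [Algebra A A']
    (M : Submonoid A) [IsLocalization M A'] (Q : Ideal A) :
    IsLocalization (M.map (Ideal.Quotient.mk Q)) (A' ⧸ Q.map (algebraMap A A')) :=
  inferInstanceAs (IsLocalization (Algebra.algebraMapSubmonoid (A ⧸ Q) M) _)

theorem isLocalization_away_quotient {A A' : Type*} [CommRing A] [CommRing A'] [Algebra A A']
    (g : A) [IsLocalization.Away g A'] (Q : Ideal A) :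
    IsLocalization.Away (Ideal.Quotient.mk Q g) (A' ⧸ Q.map (algebraMap A A')) := by
  have := isLocalization_quotient (A' := A') (Submonoid.powers g) Q
  rwa [Submonoid.map_powers] at this

theorem isPrime_map_quotient_mk {A : Type*} [CommRing A] {p Q : Ideal A} [hp : p.IsPrime]
    (h : Q ≤ p) : (p.map (Ideal.Quotient.mk Q)).IsPrime :=
  Ideal.map_isPrime_of_surjective Ideal.Quotient.mk_surjective (by rwa [Ideal.mk_ker])

theorem mk_mem_map_quotient_mk_iff {A : Type*} [CommRing A] {p Q : Ideal A} (h : Q ≤ p) (x : A) :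
    Ideal.Quotient.mk Q x ∈ p.map (Ideal.Quotient.mk Q) ↔ x ∈ p := by
  rw [← Ideal.mem_comap, Ideal.comap_map_of_surjective' _ Ideal.Quotient.mk_surjective,
    Ideal.mk_ker, sup_eq_left.mpr h]

theorem isScalarTower_quotient_map {k A A' : Type*} [CommRing k] [CommRing A] [CommRing A']
    [Algebra k A] [Algebra k A'] [Algebra A A'] [IsScalarTower k A A'] (Q : Ideal A) :
    IsScalarTower k (A ⧸ Q) (A' ⧸ Q.map (algebraMap A A')) :=
  IsScalarTower.of_algebraMap_eq fun x ↦ congrArg (Ideal.Quotient.mk (Q.map (algebraMap A A')))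
    (IsScalarTower.algebraMap_apply k A A' x)

theorem isLocalization_atPrime_quotient {A A' : Type*} [CommRing A] [CommRing A'] [Algebra A A']
    (p : Ideal A) [p.IsPrime] [IsLocalization.AtPrime A' p] (Q : Ideal A) (h : Q ≤ p)
    [(p.map (Ideal.Quotient.mk Q)).IsPrime] :
    IsLocalization.AtPrime (A' ⧸ Q.map (algebraMap A A')) (p.map (Ideal.Quotient.mk Q)) := by
  have := isLocalization_quotient (A' := A') p.primeCompl Q
  have h : p.primeCompl.map (Ideal.Quotient.mk Q) = (p.map (Ideal.Quotient.mk Q)).primeCompl := by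
    ext y
    obtain ⟨y, rfl⟩ := Ideal.Quotient.mk_surjective y
    constructor
    · rintro ⟨z, hz, hzy⟩
      rw [← hzy]
      exact fun hmem ↦ hz ((mk_mem_map_quotient_mk_iff h z).mp hmem)
    · exact fun hy ↦ ⟨y, fun hmem ↦ hy ((mk_mem_map_quotient_mk_iff h y).mpr hmem), rfl⟩
  rwa [h] at this

/-- Around a smooth point, `A ⧸ Q` is a smooth domain, whose dimension is that of the fibre of the
module of differentials. -/
theorem exists_notMem_forall_isDomain_quotient (k A κ : Type u) [Field k] [CommRing A]
    [Algebra k A] [Algebra.FiniteType k A] [Field κ] [Algebra A κ] (p Q : Ideal A) [p.IsPrime]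
    (hp : RingHom.ker (algebraMap A κ) = p) (h : Q ≤ p) [(p.map (Ideal.Quotient.mk Q)).IsPrime]
    [Algebra.IsSmoothAt k (p.map (Ideal.Quotient.mk Q))] [Algebra (A ⧸ Q) κ]
    [IsScalarTower A (A ⧸ Q) κ] :
    ∃ g ∉ p, ∀ (g' : A) (A' : Type u) [CommRing A'] [Algebra A A'] [Algebra k A']
      [IsScalarTower k A A'] [IsLocalization.Away g' A'], g ∣ g' → g' ∉ p →
      IsDomain (A' ⧸ Q.map (algebraMap A A')) ∧ Algebra.Smooth k (A' ⧸ Q.map (algebraMap A A')) ∧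
      ringKrullDim (A' ⧸ Q.map (algebraMap A A')) = Module.finrank κ (κ ⊗[A ⧸ Q] Ω[A ⧸ Q⁄k]) := by
  have : Algebra.FinitePresentation k (A ⧸ Q) :=
    Algebra.FinitePresentation.of_finiteType.mp inferInstance
  set q := p.map (Ideal.Quotient.mk Q) with hq
  obtain ⟨g₁, hg₁, h₁⟩ := Algebra.IsSmoothAt.exists_notMem_isDomain k q
  obtain ⟨g₂, hg₂, h₂⟩ := Algebra.IsSmoothAt.exists_notMem_smooth k q
  obtain ⟨g₁, rfl⟩ := Ideal.Quotient.mk_surjective g₁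
  obtain ⟨g₂, rfl⟩ := Ideal.Quotient.mk_surjective g₂
  rw [hq, mk_mem_map_quotient_mk_iff h] at hg₁ hg₂
  -- Being a domain and being smooth both survive inverting more elements outside `p`. Hence the
  -- statement for all multiples `g'`, which lets several such `g` be combined later.
  refine ⟨g₁ * g₂, ‹p.IsPrime›.mul_notMem hg₁ hg₂, ?_⟩
  intro g' A' _ _ _ _ _ hdvd hg'
  have hloc := isLocalization_away_quotient (A' := A') g' Q
  have := isScalarTower_quotient_map (k := k) (A' := A') Q
  have hgq : Ideal.Quotient.mk Q g' ∉ q := fun hmem ↦ hg' ((mk_mem_map_quotient_mk_iff h g').mp hmem)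
  have hdom : IsDomain (A' ⧸ Q.map (algebraMap A A')) := by
    refine isDomain_away_of_dvd (A₁ := Localization.Away (Ideal.Quotient.mk Q g₁)) _
      (Ideal.Quotient.mk Q g') ((map_dvd _ (dvd_mul_right g₁ g₂)).trans (map_dvd _ hdvd)) ?_
    rintro ⟨n, hn⟩
    exact hgq (‹q.IsPrime›.mem_of_pow_mem n (hn ▸ q.zero_mem))
  have hsm : Algebra.Smooth k (A' ⧸ Q.map (algebraMap A A')) := by
    have : Algebra.Smooth k (Localization.Away (Ideal.Quotient.mk Q g')) := by
      rw [← Algebra.basicOpen_subset_smoothLocus_iff_smooth] at h₂ ⊢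
      refine subset_trans ?_ h₂
      obtain ⟨c, rfl⟩ := hdvd
      rw [map_mul, map_mul, mul_right_comm, PrimeSpectrum.basicOpen_mul]
      exact fun x hx ↦ hx.2
    exact Algebra.Smooth.of_equiv ((IsLocalization.algEquiv
      (Submonoid.powers (Ideal.Quotient.mk Q g'))
      (Localization.Away (Ideal.Quotient.mk Q g')) _).restrictScalars k)
  refine ⟨hdom, hsm, ?_⟩
  let φ : (A' ⧸ Q.map (algebraMap A A')) →+* κ :=
    IsLocalization.Away.lift (Ideal.Quotient.mk Q g') (g := algebraMap (A ⧸ Q) κ) (by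
      rw [isUnit_iff_ne_zero, ← Ideal.Quotient.algebraMap_eq, ← IsScalarTower.algebraMap_apply,
        ne_eq, ← RingHom.mem_ker, hp]
      exact hg')
  let : Algebra (A' ⧸ Q.map (algebraMap A A')) κ := φ.toAlgebra
  have : IsScalarTower (A ⧸ Q) (A' ⧸ Q.map (algebraMap A A')) κ :=
    IsScalarTower.of_algebraMap_eq' (by ext x; simp [φ, RingHom.algebraMap_toAlgebra])
  have : Algebra.FormallyEtale (A ⧸ Q) (A' ⧸ Q.map (algebraMap A A')) :=
    Algebra.FormallyEtale.of_isLocalization (Submonoid.powers (Ideal.Quotient.mk Q g'))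
  rw [finrank_tensor_kaehlerDifferential_of_formallyEtale k (A ⧸ Q)
    (A' ⧸ Q.map (algebraMap A A')) κ]
  have := RingHom.ker_isPrime (algebraMap (A' ⧸ Q.map (algebraMap A A')) κ)
  exact ringKrullDim_eq_finrank_tensor_kaehlerDifferential k _ κ _ rfl

end TransverseEquations

/-! ### The affine form of the theorem -/

section TransverseEquations

open TensorProduct KaehlerDifferential

theorem free_kaehlerDifferential_of_isLocalRing (k B : Type*) [CommRing k] [CommRing B]
    [IsLocalRing B] [Algebra k B] [Algebra.EssFiniteType k B] [Algebra.FormallySmooth k B] :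
    Module.Free B Ω[B⁄k] :=
  Module.free_of_flat_of_isLocalRing

/-- The local rings of `A ⧸ Q`, seen as quotients of those of `A`. -/
theorem quotient_localization_properties (k A P κ : Type u) [Field k] [CommRing A]
    [Algebra k A] [Algebra.FiniteType k A] [CommRing P] [Algebra A P] [Algebra k P]
    [IsScalarTower k A P] [Field κ] (p Q : Ideal A) [p.IsPrime] [IsLocalization.AtPrime P p]
    (h : Q ≤ p) [Algebra (A ⧸ Q) κ] [Algebra (P ⧸ Q.map (algebraMap A P)) κ]
    [IsScalarTower (A ⧸ Q) (P ⧸ Q.map (algebraMap A P)) κ] :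
    IsLocalRing (P ⧸ Q.map (algebraMap A P)) ∧
    Algebra.EssFiniteType k (P ⧸ Q.map (algebraMap A P)) ∧
    Module.finrank κ (κ ⊗[A ⧸ Q] Ω[A ⧸ Q⁄k]) = Module.finrank κ
      (κ ⊗[P ⧸ Q.map (algebraMap A P)] Ω[P ⧸ Q.map (algebraMap A P)⁄k]) ∧
    (Algebra.Smooth k (A ⧸ Q) → Algebra.FormallySmooth k (P ⧸ Q.map (algebraMap A P))) ∧
    ∀ [(p.map (Ideal.Quotient.mk Q)).IsPrime],
      Algebra.FormallySmooth k (P ⧸ Q.map (algebraMap A P)) →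
        Algebra.IsSmoothAt k (p.map (Ideal.Quotient.mk Q)) := by
  have := isPrime_map_quotient_mk h
  have := isScalarTower_quotient_map (k := k) (A' := P) Q
  have hloc := isLocalization_atPrime_quotient (A' := P) p Q h
  have : Algebra.FormallyEtale (A ⧸ Q) (P ⧸ Q.map (algebraMap A P)) :=
    Algebra.FormallyEtale.of_isLocalization (p.map (Ideal.Quotient.mk Q)).primeCompl
  have : Algebra.EssFiniteType (A ⧸ Q) (P ⧸ Q.map (algebraMap A P)) :=
    Algebra.EssFiniteType.of_isLocalization _ (p.map (Ideal.Quotient.mk Q)).primeCompl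
  refine ⟨IsLocalization.AtPrime.isLocalRing _ (p.map (Ideal.Quotient.mk Q)),
    Algebra.EssFiniteType.comp k (A ⧸ Q) _,
    finrank_tensor_kaehlerDifferential_of_formallyEtale k (A ⧸ Q) _ κ, fun _ ↦
    Algebra.FormallySmooth.comp k (A ⧸ Q) _, fun {_} _ ↦ ?_⟩
  exact Algebra.FormallySmooth.of_equiv ((IsLocalization.algEquiv
      (p.map (Ideal.Quotient.mk Q)).primeCompl (P ⧸ Q.map (algebraMap A P))
      (Localization.AtPrime (p.map (Ideal.Quotient.mk Q)))).restrictScalars k)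

/-- Spreading out: each of the finitely many generators of `L` needs one denominator, and the
product of these serves all of `L`. -/
theorem exists_notMem_mul_mem_of_map_le {A : Type*} (P : Type*) [CommRing A] [CommRing P]
    [Algebra A P] (p : Ideal A) [p.IsPrime] [IsLocalization.AtPrime P p] {L M : Ideal A}
    (hL : L.FG) (h : L.map (algebraMap A P) ≤ M.map (algebraMap A P)) :
    ∃ g ∉ p, ∀ x ∈ L, g * x ∈ M := by
  obtain ⟨t, rfl⟩ := hL
  have (x : t) : ∃ g ∉ p, g * x.1 ∈ M := by
    have hx := h (Ideal.mem_map_of_mem _ (Ideal.subset_span x.2))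
    obtain ⟨g, hg, hgx⟩ := (IsLocalization.algebraMap_mem_map_algebraMap_iff p.primeCompl P _ _).mp hx
    exact ⟨g, hg, hgx⟩
  choose g hg hgx using this
  refine ⟨∏ x, g x, fun hmem ↦ ?_, fun x hx ↦ ?_⟩
  · obtain ⟨x, -, hx⟩ := (Ideal.IsPrime.prod_mem_iff (p := p)).mp hmem
    exact hg x hx
  · refine Submodule.span_induction (p := fun x _ ↦ (∏ x, g x) * x ∈ M) ?_ ?_ ?_ ?_ hx
    · intro y hy
      obtain ⟨c, hc⟩ := Finset.dvd_prod_of_mem g (Finset.mem_univ (⟨y, hy⟩ : t))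
      rw [hc, mul_right_comm]
      exact M.mul_mem_right _ (hgx ⟨y, hy⟩)
    · simp
    · intro x y _ _ hx hy
      rw [mul_add]
      exact M.add_mem hx hy
    · intro c x _ hx
      rw [smul_eq_mul, mul_left_comm]
      exact M.mul_mem_left _ hx

/-- The core of the algebraic half. The local ring `P` and the residue field `κ` are abstract
parameters, so the fibres of `T`, `W` and `Y` become `κ`-valued through explicit quotient maps. -/
theorem exists_ideal_le_of_smooth_of_surjective (k A P κ : Type u) [Field k] [CommRing A] [IsDomain A]
    [Algebra k A] [Algebra.Smooth k A] (I J p : Ideal A) [p.IsPrime] (hIJ : I ⊔ J ≤ p) [J.IsPrime]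
    [Algebra.Smooth k (A ⧸ J)] [Algebra.Smooth k (A ⧸ I ⊔ J)] [CommRing P] [IsLocalRing P]
    [Algebra A P] [Algebra k P] [IsScalarTower k A P] [IsLocalization.AtPrime P p] [Field κ]
    [Algebra P κ] [Algebra A κ] [Algebra k κ] [IsScalarTower A P κ] [IsScalarTower k A κ]
    (hκ : Function.Surjective (algebraMap P κ)) (hAκ : RingHom.ker (algebraMap A κ) = p) :
    ∃ K ≤ I, ∃ g ∉ p, ∀ (A' : Type u) [CommRing A'] [Algebra A A'] [Algebra k A']
      [IsScalarTower k A A'] [IsLocalization.Away g A'],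
      IsDomain (A' ⧸ K.map (algebraMap A A')) ∧
      Algebra.Smooth k (A' ⧸ K.map (algebraMap A A')) ∧
      IsDomain (A' ⧸ (I ⊔ J).map (algebraMap A A')) ∧
      (I ⊔ J).map (algebraMap A A') = (K ⊔ J).map (algebraMap A A') ∧
      ringKrullDim (A' ⧸ K.map (algebraMap A A')) + ringKrullDim (A ⧸ J) =
        ringKrullDim A + ringKrullDim (A' ⧸ (I ⊔ J).map (algebraMap A A')) := by
  have hJp : J ≤ p := le_sup_right.trans hIJ
  have hPκ (Q : Ideal A) (hQ : Q ≤ p) : Q.map (algebraMap A P) ≤ RingHom.ker (algebraMap P κ) := by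
    rw [Ideal.map_le_iff_le_comap, RingHom.comap_ker, ← IsScalarTower.algebraMap_eq, hAκ]
    exact hQ
  have : Algebra.FiniteType k A := inferInstance
  have : IsNoetherianRing A := Algebra.FiniteType.isNoetherianRing k A
  have : IsNoetherianRing P := IsLocalization.isNoetherianRing p.primeCompl P inferInstance
  have : Algebra.EssFiniteType A P := Algebra.EssFiniteType.of_isLocalization _ p.primeCompl
  have : Algebra.EssFiniteType k P := Algebra.EssFiniteType.comp k A P
  have : Algebra.FormallyEtale A P := Algebra.FormallyEtale.of_isLocalization p.primeCompl
  have : Algebra.FormallySmooth k P := Algebra.FormallySmooth.comp k A P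
  have : Module.Free P Ω[P⁄k] := free_kaehlerDifferential_of_isLocalRing k P
  -- the fibre of `T` at the point
  let : Algebra (P ⧸ J.map (algebraMap A P)) κ :=
    (Ideal.Quotient.lift _ (algebraMap P κ) (hPκ J hJp)).toAlgebra
  let : Algebra (A ⧸ J) κ := ((algebraMap (P ⧸ J.map (algebraMap A P)) κ).comp
    (algebraMap (A ⧸ J) (P ⧸ J.map (algebraMap A P)))).toAlgebra
  have : IsScalarTower (A ⧸ J) (P ⧸ J.map (algebraMap A P)) κ := .of_algebraMap_eq' rfl
  have : IsScalarTower P (P ⧸ J.map (algebraMap A P)) κ := .of_algebraMap_eq fun _ ↦ rfl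
  have : IsScalarTower A (A ⧸ J) κ := .of_algebraMap_eq fun x ↦
    IsScalarTower.algebraMap_apply A P κ x
  obtain ⟨_, _, hBrank, hBsm, -⟩ := quotient_localization_properties k A P κ p J hJp
  have := hBsm inferInstance
  have := free_kaehlerDifferential_of_isLocalRing k (P ⧸ J.map (algebraMap A P))
  -- the fibre of `S ∩ T` at the point
  let : Algebra (P ⧸ (I ⊔ J).map (algebraMap A P)) κ :=
    (Ideal.Quotient.lift _ (algebraMap P κ) (hPκ _ hIJ)).toAlgebra
  let : Algebra (A ⧸ (I ⊔ J)) κ := ((algebraMap (P ⧸ (I ⊔ J).map (algebraMap A P)) κ).comp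
    (algebraMap (A ⧸ (I ⊔ J)) (P ⧸ (I ⊔ J).map (algebraMap A P)))).toAlgebra
  have : IsScalarTower (A ⧸ (I ⊔ J)) (P ⧸ (I ⊔ J).map (algebraMap A P)) κ := .of_algebraMap_eq' rfl
  have : IsScalarTower P (P ⧸ (I ⊔ J).map (algebraMap A P)) κ := .of_algebraMap_eq fun _ ↦ rfl
  have : IsScalarTower A (A ⧸ (I ⊔ J)) κ := .of_algebraMap_eq fun x ↦
    IsScalarTower.algebraMap_apply A P κ x
  obtain ⟨_, _, hCrank, hCsm, hCsm'⟩ := quotient_localization_properties k A P κ p (I ⊔ J) hIJ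
  have := hCsm inferInstance
  let : Algebra (P ⧸ J.map (algebraMap A P)) (P ⧸ (I ⊔ J).map (algebraMap A P)) :=
    (Ideal.Quotient.factor (Ideal.map_mono le_sup_right)).toAlgebra
  have : IsScalarTower k (P ⧸ J.map (algebraMap A P)) (P ⧸ (I ⊔ J).map (algebraMap A P)) :=
    .of_algebraMap_eq fun _ ↦ rfl
  have : IsScalarTower P (P ⧸ J.map (algebraMap A P)) (P ⧸ (I ⊔ J).map (algebraMap A P)) :=
    .of_algebraMap_eq fun _ ↦ rfl
  have : IsScalarTower (P ⧸ J.map (algebraMap A P)) (P ⧸ (I ⊔ J).map (algebraMap A P)) κ :=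
    .of_algebraMap_eq fun x ↦ by
      obtain ⟨x, rfl⟩ := Ideal.Quotient.mk_surjective x
      rfl
  have hlocal {R : Type u} [CommRing R] [IsLocalRing R] [Algebra R κ] [Algebra P R]
      [IsScalarTower P R κ] : IsLocalRing.maximalIdeal R ≤ RingHom.ker (algebraMap R κ) := by
    have : Function.Surjective (algebraMap R κ) := by
      refine .of_comp (g := algebraMap P R) ?_
      rwa [← RingHom.coe_comp, ← IsScalarTower.algebraMap_eq]
    exact (IsLocalRing.eq_maximalIdeal (RingHom.ker_isMaximal_of_surjective _ this)).ge
  -- The generators of the extended ideal are indexed by `I` itself, so the chosen equations are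
  -- global elements of `I` and span an ideal `K ≤ I` of `A`.
  obtain ⟨r, s, hs, hli, hr⟩ := exists_linearIndependent_of_sup k P (P ⧸ J.map (algebraMap A P))
    (P ⧸ (I ⊔ J).map (algebraMap A P)) κ hκ Ideal.Quotient.mk_surjective
    Ideal.Quotient.mk_surjective hlocal (I.map (algebraMap A P)) (J.map (algebraMap A P))
    Ideal.mk_ker (Ideal.mk_ker.trans (Ideal.map_sup _ _ _)) (fun a : I ↦ algebraMap A P a)
    (congrArg Ideal.span (by ext; simp))
  let K : Ideal A := Ideal.span (Set.range fun i ↦ (s i : A))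
  have hKI : K ≤ I := Ideal.span_le.mpr (Set.range_subset_iff.mpr fun i ↦ (s i).2)
  have hKp : K ≤ p := hKI.trans (le_sup_left.trans hIJ)
  have hKP : K.map (algebraMap A P) =
      Ideal.span (Set.range ((fun a : I ↦ algebraMap A P a) ∘ s)) := by
    rw [Ideal.map_span, ← Set.range_comp]
    rfl
  -- the fibre of `Y` at the point
  let : Algebra (P ⧸ K.map (algebraMap A P)) κ :=
    (Ideal.Quotient.lift _ (algebraMap P κ) (hPκ K hKp)).toAlgebra
  let : Algebra (A ⧸ K) κ := ((algebraMap (P ⧸ K.map (algebraMap A P)) κ).comp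
    (algebraMap (A ⧸ K) (P ⧸ K.map (algebraMap A P)))).toAlgebra
  have : IsScalarTower (A ⧸ K) (P ⧸ K.map (algebraMap A P)) κ := .of_algebraMap_eq' rfl
  have : IsScalarTower P (P ⧸ K.map (algebraMap A P)) κ := .of_algebraMap_eq fun _ ↦ rfl
  have : IsScalarTower A (A ⧸ K) κ := .of_algebraMap_eq fun x ↦
    IsScalarTower.algebraMap_apply A P κ x
  obtain ⟨_, _, hDrank, -, hDsm⟩ := quotient_localization_properties k A P κ p K hKp
  obtain ⟨hD, hD'⟩ := formallySmooth_of_linearIndependent k P (P ⧸ K.map (algebraMap A P)) κ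
    Ideal.Quotient.mk_surjective hlocal _ (Ideal.mk_ker.trans hKP) hli
  have := isPrime_map_quotient_mk hKp
  have := isPrime_map_quotient_mk hIJ
  have := hDsm hD
  have := hCsm' inferInstance
  -- `g₁` handles `Y`, `g₂` handles `W`, and `g₃` spreads the equality `K + J = I + J` from the
  -- local ring.
  obtain ⟨g₁, hg₁, h₁⟩ := exists_notMem_forall_isDomain_quotient k A κ p K hAκ hKp
  obtain ⟨g₂, hg₂, h₂⟩ := exists_notMem_forall_isDomain_quotient k A κ p (I ⊔ J) hAκ hIJ
  obtain ⟨g₃, hg₃, h₃⟩ := exists_notMem_mul_mem_of_map_le P p (L := I) (M := K ⊔ J)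
    (IsNoetherian.noetherian I) (by
      rw [Ideal.map_sup, hKP, ← hs]
      exact le_sup_left)
  refine ⟨K, hKI, g₁ * g₂ * g₃, ‹p.IsPrime›.mul_notMem (‹p.IsPrime›.mul_notMem hg₁ hg₂) hg₃, ?_⟩
  intro A' _ _ _ _ _
  have hgp := ‹p.IsPrime›.mul_notMem (‹p.IsPrime›.mul_notMem hg₁ hg₂) hg₃
  obtain ⟨hd₁, hs₁, hr₁⟩ := h₁ (g₁ * g₂ * g₃) A' (by rw [mul_assoc]; exact dvd_mul_right _ _) hgp
  obtain ⟨hd₂, hs₂, hr₂⟩ := h₂ (g₁ * g₂ * g₃) A' ((dvd_mul_left _ _).mul_right _) hgp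
  refine ⟨hd₁, hs₁, hd₂, le_antisymm ?_ (Ideal.map_mono (sup_le_sup_right hKI J)), ?_⟩
  · rw [Ideal.map_le_iff_le_comap]
    refine sup_le (fun x hx ↦ ?_) (le_sup_right.trans Ideal.le_comap_map)
    have hu : IsUnit (algebraMap A A' g₃) := isUnit_of_dvd_unit (map_dvd _ (dvd_mul_left _ _))
      (IsLocalization.Away.algebraMap_isUnit (g₁ * g₂ * g₃))
    have := Ideal.mem_map_of_mem (algebraMap A A') (h₃ x hx)
    rw [map_mul] at this
    exact (Ideal.unit_mul_mem_iff_mem _ hu).mp this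
  · have hpJ := isPrime_map_quotient_mk hJp
    have hkerJ : RingHom.ker (algebraMap (A ⧸ J) κ) = p.map (Ideal.Quotient.mk J) := by
      rw [← hAκ, IsScalarTower.algebraMap_eq A (A ⧸ J) κ, ← RingHom.comap_ker]
      exact (Ideal.map_comap_of_surjective _ Ideal.Quotient.mk_surjective _).symm
    -- All four dimensions become fibre ranks at the point; `r` is the drop both from `X` to `Y` and
    -- from `T` to `W`.
    rw [hr₁, hr₂, ringKrullDim_eq_finrank_tensor_kaehlerDifferential k A κ p hAκ,
      ringKrullDim_eq_finrank_tensor_kaehlerDifferential k (A ⧸ J) κ _ hkerJ, hBrank, hCrank,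
      hDrank, finrank_tensor_kaehlerDifferential_of_formallyEtale k A P κ, hr, hD']
    norm_cast
    ring

/-- Let `X = Spec A`, `S = V(I)`, `T = V(J)`, where `X`, `T` and `S ∩ T` are smooth. Around
each point of `S ∩ T` there is a smooth `Y = V(K)` with `S ⊆ Y` and `Y ∩ T = S ∩ T`, which meets
`T` in the expected dimension. -/
theorem exists_ideal_le_of_smooth (k A : Type u) [Field k] [CommRing A] [IsDomain A] [Algebra k A]
    [Algebra.Smooth k A] (I J p : Ideal A) [p.IsPrime] (hIJ : I ⊔ J ≤ p) [J.IsPrime]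
    [Algebra.Smooth k (A ⧸ J)] [Algebra.Smooth k (A ⧸ I ⊔ J)] :
    ∃ K ≤ I, ∃ g ∉ p, ∀ (A' : Type u) [CommRing A'] [Algebra A A'] [Algebra k A']
      [IsScalarTower k A A'] [IsLocalization.Away g A'],
      IsDomain (A' ⧸ K.map (algebraMap A A')) ∧
      Algebra.Smooth k (A' ⧸ K.map (algebraMap A A')) ∧
      IsDomain (A' ⧸ (I ⊔ J).map (algebraMap A A')) ∧
      (I ⊔ J).map (algebraMap A A') = (K ⊔ J).map (algebraMap A A') ∧
      ringKrullDim (A' ⧸ K.map (algebraMap A A')) + ringKrullDim (A ⧸ J) =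
        ringKrullDim A + ringKrullDim (A' ⧸ (I ⊔ J).map (algebraMap A A')) := by
  exact exists_ideal_le_of_smooth_of_surjective k A (Localization.AtPrime p) p.ResidueField I J p hIJ
    Ideal.Quotient.mk_surjective (Ideal.ker_algebraMap_residueField p)

end TransverseEquations

/-! ### Dimension of schemes via affine opens -/

section Dimension

open TopologicalSpace

/-- A chain of irreducible closed sets starting at `Z` consists of sets containing a given `z ∈ Z`,
so it is seen in any open neighbourhood of `z`. Thus coheights can be computed there. -/
theorem topologicalKrullDim_le_of_forall_exists_isOpen {X : Type*} [TopologicalSpace X]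
    {d : WithBot ℕ∞} (h : ∀ x : X, ∃ U : Opens X, x ∈ U ∧ topologicalKrullDim U ≤ d) :
    topologicalKrullDim X ≤ d := by
  rw [topologicalKrullDim, Order.krullDim_eq_iSup_coheight]
  refine iSup_le fun Z ↦ ?_
  obtain ⟨z, hz⟩ := Z.2.nonempty
  obtain ⟨U, hzU, hU⟩ := h z
  have hemb := U.isOpen.isOpenEmbedding_subtypeVal
  let Z' := (IrreducibleCloseds.orderIsoOfIsOpenEmbedding _ hemb).symm ⟨Z, ⟨⟨z, hzU⟩, hz⟩⟩
  have hZ' : IrreducibleCloseds.map _ hemb.continuous Z' = Z :=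
    congrArg Subtype.val
      ((IrreducibleCloseds.orderIsoOfIsOpenEmbedding _ hemb).apply_symm_apply ⟨Z, ⟨⟨z, hzU⟩, hz⟩⟩)
  rw [← hZ', hemb.coheight_map]
  exact (Order.coheight_le_krullDim Z').trans hU

/-- The structure map of the sections over `U` of a scheme over `k`. -/
noncomputable def AlgebraicGeometry.Scheme.Hom.scalars {k : Type u} [Field k] {X : Scheme.{u}}
    (p : X ⟶ Spec (.of k)) (U : X.Opens) : k →+* Γ(X, U) :=
  ((Scheme.ΓSpecIso (.of k)).inv ≫ p.appLE ⊤ U (by simp)).hom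

variable {k : Type u} [Field k] {X : Scheme.{u}} (p : X ⟶ Spec (.of k))

theorem AlgebraicGeometry.Scheme.Hom.map_scalars {U V : X.Opens} (h : U ⟶ V) (c : k) :
    X.presheaf.map h.op (p.scalars V c) = p.scalars U c := by
  have : ((Scheme.ΓSpecIso (.of k)).inv ≫ p.appLE ⊤ V (by simp)) ≫ X.presheaf.map h.op =
      (Scheme.ΓSpecIso (.of k)).inv ≫ p.appLE ⊤ U (by simp) :=
    (Category.assoc _ _ _).trans (congrArg _ (p.appLE_map _ _))
  exact congr($this c)

theorem AlgebraicGeometry.HasRingHomProperty.scalars {P : MorphismProperty Scheme.{u}}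
    {Q : ∀ {R S : Type u} [CommRing R] [CommRing S], (R →+* S) → Prop} [HasRingHomProperty P Q]
    (hp : P p) {U : X.Opens} (hU : IsAffineOpen U) : Q (p.scalars U) := by
  have := HasRingHomProperty.appLE (P := P) p hp ⟨⊤, isAffineOpen_top _⟩ ⟨U, hU⟩ (by simp)
  rw [Scheme.Hom.scalars, CommRingCat.hom_comp,
    (HasRingHomProperty.isLocal_ringHomProperty P).respectsIso.cancel_left_isIso]
  exact this

theorem topologicalKrullDim_eq_ringKrullDim_of_isAffine (Y : Scheme.{u}) [IsAffine Y] :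
    topologicalKrullDim Y = ringKrullDim Γ(Y, ⊤) := by
  rw [IsHomeomorph.topologicalKrullDim_eq _ Y.isoSpec.hom.homeomorph.isHomeomorph]
  exact PrimeSpectrum.topologicalKrullDim_eq_ringKrullDim _

theorem topologicalKrullDim_eq_ringKrullDim_of_isAffineOpen {U : X.Opens} (hU : IsAffineOpen U) :
    topologicalKrullDim U = ringKrullDim Γ(X, U) := by
  rw [IsHomeomorph.topologicalKrullDim_eq _ hU.isoSpec.hom.homeomorph.isHomeomorph]
  exact PrimeSpectrum.topologicalKrullDim_eq_ringKrullDim _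

/-- Both sides are the transcendence degree of the function field over `k`. -/
theorem ringKrullDim_sections_eq [IsIntegral X] [LocallyOfFiniteType p] {U V : X.Opens}
    (hU : IsAffineOpen U) (hV : IsAffineOpen V) [Nonempty U] [Nonempty V] :
    ringKrullDim Γ(X, U) = ringKrullDim Γ(X, V) := by
  let : Algebra k X.functionField :=
    ((X.presheaf.germ ⊤ (genericPoint X) trivial).hom.comp (p.scalars ⊤)).toAlgebra
  have key (U : X.Opens) (hU : IsAffineOpen U) [Nonempty U] :
      ∃ n : ℕ, ringKrullDim Γ(X, U) = n ∧ Algebra.trdeg k X.functionField = n := by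
    let : Algebra k Γ(X, U) := (p.scalars U).toAlgebra
    have : Algebra.FiniteType k Γ(X, U) :=
      HasRingHomProperty.scalars (P := @LocallyOfFiniteType) p inferInstance hU
    have := functionField_isFractionRing_of_isAffineOpen X U hU
    have : IsScalarTower k Γ(X, U) X.functionField := .of_algebraMap_eq fun c ↦ by
      change X.presheaf.germ ⊤ (genericPoint X) trivial (p.scalars ⊤ c) =
        X.germToFunctionField U (p.scalars U c)
      rw [← p.map_scalars (homOfLE le_top : U ⟶ ⊤) c]
      exact (TopCat.Presheaf.germ_res_apply _ _ _ _ _).symm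
    have htr := Algebra.trdeg_eq_of_isLocalization (k := k) (A := Γ(X, U)) (B := X.functionField)
      (nonZeroDivisors _)
    obtain ⟨n, hn⟩ := Cardinal.lt_aleph0.mp (trdeg_lt_aleph0_of_finiteType (R := k) (S := Γ(X, U)))
    exact ⟨n, ringKrullDim_eq_of_trdeg_eq hn, htr.symm.trans hn⟩
  obtain ⟨n, hn, hn'⟩ := key U hU
  obtain ⟨m, hm, hm'⟩ := key V hV
  rw [hn, hm, Nat.cast_injective (hn'.symm.trans hm')]

theorem topologicalKrullDim_eq_ringKrullDim_sections [IsIntegral X] [LocallyOfFiniteType p]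
    {V : X.Opens} (hV : IsAffineOpen V) [Nonempty V] :
    topologicalKrullDim X = ringKrullDim Γ(X, V) := by
  apply le_antisymm
  · refine topologicalKrullDim_le_of_forall_exists_isOpen fun x ↦ ?_
    obtain ⟨U, hU, hxU, -⟩ := exists_isAffineOpen_mem_and_subset (X := X) (x := x) (U := ⊤) trivial
    have : Nonempty U := ⟨⟨x, hxU⟩⟩
    exact ⟨U, hxU, (topologicalKrullDim_eq_ringKrullDim_of_isAffineOpen hU).le.trans
      (ringKrullDim_sections_eq p hU hV).le⟩
  · rw [← topologicalKrullDim_eq_ringKrullDim_of_isAffineOpen hV]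
    exact topologicalKrullDim_subspace_le X V

end Dimension

/-! ### Closed subschemes and their ideals -/

section ClosedSubschemes

/-- The ideal sheaf of an intersection is the sum of the ideal sheaves. -/
theorem AlgebraicGeometry.ker_pullback_fst_comp {X S T : Scheme.{u}} (i : S ⟶ X) (j : T ⟶ X)
    [IsClosedImmersion i] [IsClosedImmersion j] :
    (pullback.fst i j ≫ i).ker = i.ker ⊔ j.ker := by
  apply le_antisymm
  -- The closed subscheme cut out by the sum factors through `S` and through `T`, hence through the
  -- fibre product.
  · let I := i.ker ⊔ j.ker
    have hI : I.subschemeι.ker = I := I.ker_subschemeι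
    let a := IsClosedImmersion.lift i I.subschemeι (le_sup_left.trans hI.ge)
    let b := IsClosedImmersion.lift j I.subschemeι (le_sup_right.trans hI.ge)
    have ha : a ≫ i = I.subschemeι := IsClosedImmersion.lift_fac ..
    have hb : b ≫ j = I.subschemeι := IsClosedImmersion.lift_fac ..
    have hab : pullback.lift a b (ha.trans hb.symm) ≫ pullback.fst i j ≫ i = I.subschemeι := by
      rw [pullback.lift_fst_assoc, ha]
    refine le_trans ?_ hI.le
    rw [← hab]
    exact Scheme.Hom.le_ker_comp _ _
  · refine sup_le (Scheme.Hom.le_ker_comp _ _) ?_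
    rw [pullback.condition]
    exact Scheme.Hom.le_ker_comp _ _

/-- Sections of a closed subscheme over an affine open subset. -/
noncomputable def AlgebraicGeometry.Scheme.Hom.quotientKerEquiv {X Z : Scheme.{u}} (f : Z ⟶ X)
    [IsClosedImmersion f] {V : X.Opens} (hV : IsAffineOpen V) :
    Γ(X, V) ⧸ f.ker.ideal ⟨V, hV⟩ ≃+* Γ(Z, f ⁻¹ᵁ V) :=
  (Ideal.quotEquivOfEq (f.ker_apply ⟨V, hV⟩)).trans
    (RingHom.quotientKerEquivOfSurjective (f.app_surjective V hV))

theorem topologicalKrullDim_eq_ringKrullDim_quotient_ker {X Z : Scheme.{u}} [IsAffine X]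
    (f : Z ⟶ X) [IsClosedImmersion f] :
    topologicalKrullDim Z = ringKrullDim (Γ(X, ⊤) ⧸ f.ker.ideal ⟨⊤, isAffineOpen_top X⟩) := by
  have := isAffine_of_isAffineHom f
  rw [topologicalKrullDim_eq_ringKrullDim_of_isAffine Z]
  exact (ringKrullDim_eq_of_ringEquiv (f.quotientKerEquiv (isAffineOpen_top X))).symm

variable {k : Type u} [Field k] {X : Scheme.{u}} (p : X ⟶ Spec (.of k))

theorem AlgebraicGeometry.Scheme.Hom.app_scalars {Z : Scheme.{u}} (f : Z ⟶ X) (V : X.Opens)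
    (c : k) : f.app V (p.scalars V c) = (f ≫ p).scalars (f ⁻¹ᵁ V) c := by
  have : ((Scheme.ΓSpecIso (.of k)).inv ≫ p.appLE ⊤ V (by simp)) ≫ f.app V =
      (Scheme.ΓSpecIso (.of k)).inv ≫ (f ≫ p).appLE ⊤ (f ⁻¹ᵁ V) (by simp) := by
    refine (Category.assoc _ _ _).trans (congrArg _ ?_)
    rw [f.app_eq_appLE]
    exact Scheme.Hom.appLE_comp_appLE ..
  exact congr($this c)

theorem smooth_quotient_ker {Z : Scheme.{u}} (f : Z ⟶ X) [IsClosedImmersion f] [Smooth (f ≫ p)]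
    {V : X.Opens} (hV : IsAffineOpen V) [Algebra k Γ(X, V)]
    (h : ∀ c, algebraMap k Γ(X, V) c = p.scalars V c) :
    Algebra.Smooth k (Γ(X, V) ⧸ f.ker.ideal ⟨V, hV⟩) := by
  let : Algebra k Γ(Z, f ⁻¹ᵁ V) := ((f ≫ p).scalars (f ⁻¹ᵁ V)).toAlgebra
  have : Algebra.Smooth k Γ(Z, f ⁻¹ᵁ V) :=
    HasRingHomProperty.scalars (P := @Smooth) (f ≫ p) inferInstance (hV.preimage f)
  let e : (Γ(X, V) ⧸ f.ker.ideal ⟨V, hV⟩) ≃ₐ[k] Γ(Z, f ⁻¹ᵁ V) :=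
    AlgEquiv.ofRingEquiv (f := f.quotientKerEquiv hV) fun c ↦ by
      change f.app V (algebraMap k Γ(X, V) c) = _
      rw [h]
      exact p.app_scalars f V c
  exact Algebra.Smooth.of_equiv e.symm

theorem AlgebraicGeometry.Scheme.isoSpec_hom_comp_SpecMap_scalars [IsAffine X] :
    X.isoSpec.hom ≫ Spec.map (CommRingCat.ofHom (p.scalars ⊤)) = p := by
  have : CommRingCat.ofHom (p.scalars ⊤) = (Scheme.ΓSpecIso (.of k)).inv ≫ p.appTop := by
    rw [Scheme.Hom.appTop, p.app_eq_appLE]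
    rfl
  rw [this, Spec.map_comp, Scheme.isoSpec_hom, ← Scheme.toSpecΓ_naturality_assoc,
    ← SpecMap_ΓSpecIso_hom, ← Spec.map_comp]
  simp

theorem isSmoothVariety_SpecMap_quotient_mk [IsAffine X] (K : Ideal Γ(X, ⊤)) [Algebra k Γ(X, ⊤)]
    (h : ∀ c, algebraMap k Γ(X, ⊤) c = p.scalars ⊤ c) [IsDomain (Γ(X, ⊤) ⧸ K)]
    [Algebra.Smooth k (Γ(X, ⊤) ⧸ K)] :
    IsSmoothVariety ((Spec.map (CommRingCat.ofHom (Ideal.Quotient.mk K)) ≫ X.isoSpec.inv) ≫ p) := by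
  have hp : (Spec.map (CommRingCat.ofHom (Ideal.Quotient.mk K)) ≫ X.isoSpec.inv) ≫ p =
      Spec.map (CommRingCat.ofHom (algebraMap k (Γ(X, ⊤) ⧸ K))) := by
    rw [Category.assoc, ← Scheme.isoSpec_hom_comp_SpecMap_scalars p, Iso.inv_hom_id_assoc,
      ← Spec.map_comp, ← CommRingCat.ofHom_comp]
    congr 2
    ext c
    exact congrArg _ (h c).symm
  rw [hp]
  have : Smooth (Spec.map (CommRingCat.ofHom (algebraMap k (Γ(X, ⊤) ⧸ K)))) := by
    rw [HasRingHomProperty.Spec_iff (P := @Smooth)]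
    exact RingHom.smooth_algebraMap.mpr inferInstance
  exact ⟨inferInstance, inferInstance, inferInstance, inferInstance, this⟩

theorem ker_SpecMap_quotient_mk_comp [IsAffine X] (K : Ideal Γ(X, ⊤)) :
    (Spec.map (CommRingCat.ofHom (Ideal.Quotient.mk K)) ≫ X.isoSpec.inv).ker.ideal
      ⟨⊤, isAffineOpen_top X⟩ = K := by
  have h : (Spec.map (CommRingCat.ofHom (Ideal.Quotient.mk K)) ≫ X.isoSpec.inv).appTop =
      CommRingCat.ofHom (Ideal.Quotient.mk K) ≫ (Scheme.ΓSpecIso _).inv := by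
    rw [Scheme.Hom.comp_appTop, Scheme.ΓSpecIso_inv_naturality]
    have hX : X.isoSpec.inv.appTop = (Scheme.ΓSpecIso Γ(X, ⊤)).inv := by
      have := congr($(X.isoSpec.inv_hom_id).appTop)
      rw [Scheme.Hom.comp_appTop, Scheme.isoSpec_hom, Scheme.toSpecΓ_appTop,
        Scheme.Hom.id_appTop] at this
      rw [← cancel_epi (Scheme.ΓSpecIso Γ(X, ⊤)).hom, this, Iso.hom_inv_id]
    rw [hX]
    rfl
  rw [Scheme.Hom.ker_apply]
  change RingHom.ker (Scheme.Hom.appTop _).hom = K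
  rw [h]
  ext x
  rw [CommRingCat.hom_comp, RingHom.mem_ker, RingHom.comp_apply,
    map_eq_zero_iff _ (ConcreteCategory.bijective_of_isIso (Scheme.ΓSpecIso _).inv).1]
  exact Ideal.Quotient.eq_zero_iff_mem

end ClosedSubschemes

/-! ### The theorem for varieties -/

section Schemes

theorem mem_basicOpen_iff_notMem_primeIdealOf {X : Scheme.{u}} {V : X.Opens} (hV : IsAffineOpen V)
    (x : V) (g : Γ(X, V)) : x.1 ∈ X.basicOpen g ↔ g ∉ (hV.primeIdealOf x).asIdeal := by
  rw [X.mem_basicOpen _ _ x.2, hV.primeIdealOf_eq_map_closedPoint]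
  exact IsLocalRing.notMem_maximalIdeal.symm

/-- A section that pulls back to zero on `Z` cannot be invertible at a point of the image of `Z`. -/
theorem ker_ideal_le_primeIdealOf {X Z : Scheme.{u}} (f : Z ⟶ X) [QuasiCompact f] {V : X.Opens}
    (hV : IsAffineOpen V) (z : Z) (hz : f z ∈ V) :
    f.ker.ideal ⟨V, hV⟩ ≤ (hV.primeIdealOf ⟨f z, hz⟩).asIdeal := by
  intro a ha
  by_contra h
  rw [← mem_basicOpen_iff_notMem_primeIdealOf] at h
  rw [f.ker_apply] at ha
  have h' : z ∈ f ⁻¹ᵁ X.basicOpen a := h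
  rw [Scheme.preimage_basicOpen, show f.app V a = 0 from ha, Scheme.basicOpen_zero] at h'
  exact h'

variable {k : Type u} [Field k] {X S T : Scheme.{u}} (p : X ⟶ Spec (.of k)) (i : S ⟶ X) (j : T ⟶ X)

/-- The affine form is applied on an affine `V` containing the point. Then `U` is the basic open set
of `g`, and `Y` is the spectrum of the quotient of its ring of functions by the extension of `K`. -/
theorem exists_smooth_closed_subscheme_containing (hp : IsSmoothVariety p) [IsClosedImmersion i]
    [IsClosedImmersion j] (hT : IsSmoothVariety (j ≫ p))
    (hW : Smooth (pullback.fst i j ≫ i ≫ p)) (w : (pullback i j : Scheme.{u})) :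
    ∃ U : X.Opens, (pullback.fst i j ≫ i) w ∈ U ∧
      ∃ (Y : Scheme.{u}) (y : Y ⟶ (U : Scheme.{u})),
        IsClosedImmersion y ∧ IsSmoothVariety (y ≫ U.ι ≫ p) ∧
        (∃ g : ((i ⁻¹ᵁ U : S.Opens) : Scheme.{u}) ⟶ Y, g ≫ y = i ∣_ U) ∧
        (∃ e : (((pullback.fst i j ≫ i) ⁻¹ᵁ U : (pullback i j).Opens) : Scheme.{u}) ≅
            pullback y (j ∣_ U),
          e.hom ≫ pullback.fst y (j ∣_ U) ≫ y = (pullback.fst i j ≫ i) ∣_ U) ∧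
        topologicalKrullDim Y + topologicalKrullDim T =
          topologicalKrullDim X +
            topologicalKrullDim ((pullback.fst i j ≫ i) ⁻¹ᵁ U : (pullback i j).Opens) := by
  obtain ⟨_, _, _, _, _⟩ := hp
  obtain ⟨_, _, _, _, _⟩ := hT
  obtain ⟨V, hV, hxV, -⟩ := exists_isAffineOpen_mem_and_subset (X := X)
    (x := (pullback.fst i j ≫ i) w) (U := ⊤) trivial
  set q := pullback.fst i j ≫ i with hq
  have : IsClosedImmersion q := inferInstance
  have : Smooth (q ≫ p) := by rwa [hq, Category.assoc]
  have hqj : q = pullback.snd i j ≫ j := pullback.condition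
  have : Nonempty V := ⟨⟨_, hxV⟩⟩
  have : Nonempty (j ⁻¹ᵁ V) := ⟨⟨pullback.snd i j w, by
    change (pullback.snd i j ≫ j) w ∈ V
    rwa [← hqj]⟩⟩
  let : Algebra k Γ(X, V) := (p.scalars V).toAlgebra
  let V' : X.affineOpens := ⟨V, hV⟩
  let I := i.ker.ideal V'
  let J := j.ker.ideal V'
  have hIJ : q.ker.ideal V' = I ⊔ J := by
    rw [hq, AlgebraicGeometry.ker_pullback_fst_comp]
    rfl
  let P := (hV.primeIdealOf ⟨q w, hxV⟩).asIdeal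
  have hIJP : I ⊔ J ≤ P := hIJ ▸ ker_ideal_le_primeIdealOf q hV w hxV
  have : Algebra.Smooth k Γ(X, V) :=
    HasRingHomProperty.scalars (P := @Smooth) p inferInstance hV
  have : Algebra.Smooth k (Γ(X, V) ⧸ J) := smooth_quotient_ker p j hV fun _ ↦ rfl
  have : Algebra.Smooth k (Γ(X, V) ⧸ I ⊔ J) := by
    rw [← hIJ]
    exact smooth_quotient_ker p q hV fun _ ↦ rfl
  have : J.IsPrime := by
    rw [← Ideal.Quotient.isDomain_iff_prime]
    exact (j.quotientKerEquiv hV).toMulEquiv.isDomain _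
  obtain ⟨K, hKI, g, hg, H⟩ := exists_ideal_le_of_smooth k Γ(X, V) I J P hIJP
  let U := X.basicOpen g
  have hU : IsAffineOpen U := hV.basicOpen g
  have hUV : U ≤ V := X.basicOpen_le g
  have : IsAffine U := hU
  have hU' : IsAffineOpen (U.ι ''ᵁ ⊤) := (isAffineOpen_top U.toScheme).image_of_isOpenImmersion U.ι
  have hle : U.ι ''ᵁ ⊤ ≤ V := by simpa using hUV
  let r : Γ(X, V) →+* Γ(U.toScheme, ⊤) := (X.presheaf.map (homOfLE hle).op).hom
  let : Algebra Γ(X, V) Γ(U.toScheme, ⊤) := r.toAlgebra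
  let : Algebra k Γ(U.toScheme, ⊤) := (r.comp (p.scalars V)).toAlgebra
  have : IsScalarTower k Γ(X, V) Γ(U.toScheme, ⊤) := .of_algebraMap_eq' rfl
  have : IsLocalization.Away g Γ(U.toScheme, ⊤) :=
    hV.isLocalization_of_eq_basicOpen g (homOfLE hle) (by simp [U])
  obtain ⟨hdY, hsY, hdW, hKJ, hdim⟩ := H Γ(U.toScheme, ⊤)
  let K' := K.map r
  have hk (c : k) : algebraMap k Γ(U.toScheme, ⊤) c = (U.ι ≫ p).scalars ⊤ c := by
    have h := p.app_scalars U.ι ⊤ c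
    rw [Scheme.Opens.ι_app] at h
    change X.presheaf.map (homOfLE hle).op (p.scalars V c) = (U.ι ≫ p).scalars (U.ι ⁻¹ᵁ ⊤) c
    rw [← h, p.map_scalars]
    exact (p.map_scalars _ c).symm
  have hres {Z : Scheme.{u}} (f : Z ⟶ X) [IsClosedImmersion f] :
      (f ∣_ U).ker.ideal ⟨⊤, isAffineOpen_top U.toScheme⟩ = (f.ker.ideal V').map r := by
    rw [Scheme.ker_morphismRestrict_ideal]
    exact (f.ker.map_ideal (U := ⟨U.ι ''ᵁ ⊤, hU'⟩) (V := V') hle).symm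
  let y : Spec (.of (Γ(U.toScheme, ⊤) ⧸ K')) ⟶ U.toScheme :=
    Spec.map (CommRingCat.ofHom (Ideal.Quotient.mk K')) ≫ U.toScheme.isoSpec.inv
  have hyK : y.ker.ideal ⟨⊤, isAffineOpen_top U.toScheme⟩ = K' := ker_SpecMap_quotient_mk_comp K'
  have : IsClosedImmersion y := inferInstance
  -- Closed immersions into `U` with equal kernels are isomorphic over `U`, so the scheme-theoretic
  -- intersection reduces to `K + J = I + J` on global sections.
  have hker : (pullback.fst y (j ∣_ U) ≫ y).ker = (q ∣_ U).ker := by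
    rw [AlgebraicGeometry.ker_pullback_fst_comp]
    refine Scheme.IdealSheafData.ext_of_isAffine ?_
    rw [hres q, hIJ]
    refine (congrArg₂ (· ⊔ ·) hyK (hres j)).trans ?_
    exact (Ideal.map_sup _ _ _).symm.trans hKJ.symm
  have hiso := IsClosedImmersion.isIso_lift _ _ hker
  refine ⟨U, (mem_basicOpen_iff_notMem_primeIdealOf hV ⟨q w, hxV⟩ g).mpr hg, _, y, inferInstance,
    ?_, ⟨IsClosedImmersion.lift y (i ∣_ U) ?_, IsClosedImmersion.lift_fac ..⟩,
    ⟨@asIso _ _ _ _ _ hiso, IsClosedImmersion.lift_fac ..⟩, ?_⟩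
  · exact isSmoothVariety_SpecMap_quotient_mk (U.ι ≫ p) K' hk
  · refine Scheme.IdealSheafData.le_of_isAffine ?_
    rw [hyK, hres i]
    exact Ideal.map_mono hKI
  · rw [topologicalKrullDim_eq_ringKrullDim_quotient_ker y,
      topologicalKrullDim_eq_ringKrullDim_sections p hV,
      topologicalKrullDim_eq_ringKrullDim_sections (j ≫ p) (hV.preimage j)]
    have hW : topologicalKrullDim (q ⁻¹ᵁ U : (pullback i j).Opens) =
        ringKrullDim (Γ(U.toScheme, ⊤) ⧸ (I ⊔ J).map r) := by
      refine (topologicalKrullDim_eq_ringKrullDim_quotient_ker (q ∣_ U)).trans ?_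
      rw [hres q, hIJ]
    rw [hW, hyK, ← ringKrullDim_eq_of_ringEquiv (j.quotientKerEquiv hV)]
    exact hdim

end Schemes

/-! ### Linear forms on a subspace and the dimension count -/

section LinearAlgebra

/-- Finitely many of the given linear forms have the same common kernel on `B` as all of them and
are linearly independent on `B`. -/
theorem exists_rightInverse_of_forms {K E ι : Type*} [Field K] [AddCommGroup E] [Module K E]
    [FiniteDimensional K E] (B : Submodule K E) (l : ι → E →ₗ[K] K) :
    ∃ (r : ℕ) (f : Fin r → ι) (s : (Fin r → K) →ₗ[K] E), (∀ c, s c ∈ B) ∧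
      (∀ c i, l (f i) (s c) = c i) ∧ ∀ b ∈ B, (∀ i, l (f i) b = 0) → ∀ j, l j b = 0 := by
  let m : ι → Module.Dual K B := fun i ↦ (l i).domRestrict B
  obtain ⟨g, hg, hspan, hli⟩ := Submodule.exists_fun_fin_finrank_span_eq K (Set.range m)
  choose f hf using hg
  let M : B →ₗ[K] (Fin _ → K) := LinearMap.pi g
  -- A functional vanishing on the range of `M` would be a linear relation among the independent
  -- forms `g`.
  have hM : LinearMap.range M = ⊤ := by
    by_contra hne
    obtain ⟨φ, hφ, hle⟩ := Submodule.exists_le_ker_of_lt_top _ (lt_top_iff_ne_top.mpr hne)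
    apply hφ
    have hsum (v) : φ v = ∑ i, φ (Pi.single i 1) * v i := by
      rw [LinearMap.pi_apply_eq_sum_univ φ v]
      exact Finset.sum_congr rfl fun i _ ↦ by
        rw [smul_eq_mul, mul_comm]
        congr 2
        ext j
        simp [Pi.single_apply, eq_comm]
    have h0 : ∑ i, φ (Pi.single i 1) • g i = 0 := by
      ext b
      have : φ (M b) = 0 := hle ⟨b, rfl⟩
      rw [hsum] at this
      simpa [M] using this
    have := Fintype.linearIndependent_iff.mp hli _ h0
    ext i
    simpa using this i
  obtain ⟨s, hs⟩ := M.exists_rightInverse_of_surjective hM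
  refine ⟨_, f, B.subtype ∘ₗ s, fun c ↦ (s c).2, fun c i ↦ ?_, fun b hb h j ↦ ?_⟩
  · have := congr($hs c i)
    simpa [M, ← hf, m] using this
  · have hj : m j ∈ Submodule.span K (Set.range g) := by
      rw [hspan]
      exact Submodule.subset_span ⟨j, rfl⟩
    have : ∀ x ∈ Submodule.span K (Set.range g), x ⟨b, hb⟩ = 0 := by
      intro x hx
      induction hx using Submodule.span_induction with
      | mem x hx =>
        obtain ⟨i, rfl⟩ := hx
        rw [← hf]
        exact h i
      | zero => rfl
      | add x y _ _ hx hy => simp [hx, hy]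
      | smul a x _ hx => simp [hx]
    exact this _ hj

/-- Since `e = P e + (e - P e)`, the image of `P` and `B` together span `E`; this transversality is
the expected-dimension formula. -/
theorem finrank_range_add_finrank {K E : Type*} [Field K] [AddCommGroup E] [Module K E]
    [FiniteDimensional K E] (P : E →ₗ[K] E) (B : Submodule K E) (h : ∀ e, e - P e ∈ B) :
    Module.finrank K (LinearMap.range P) + Module.finrank K B =
      Module.finrank K E + Module.finrank K (LinearMap.range P ⊓ B : Submodule K E) := by
  have htop : LinearMap.range P ⊔ B = ⊤ := by
    refine eq_top_iff.mpr fun e _ ↦ ?_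
    rw [← add_sub_cancel (P e) e]
    exact Submodule.add_mem_sup ⟨e, rfl⟩ (h e)
  rw [← Submodule.finrank_sup_add_finrank_inf_eq, htop, finrank_top]

end LinearAlgebra

/-! ### Holomorphic inverse function theorem -/

section LocalInverse

variable {E : Type*} [NormedAddCommGroup E] [NormedSpace ℂ E]

/-- The inverse function theorem, with the source shrunk to an open set on which both the map and
its inverse are analytic at every point, as membership in the maximal atlas requires. -/
theorem exists_openPartialHomeomorph_of_contDiffAt [CompleteSpace E] {f : E → E} {a : E}
    (hf : ContDiffAt ℂ ω f a) (hf' : HasFDerivAt f (ContinuousLinearMap.id ℂ E) a) :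
    ∃ G : OpenPartialHomeomorph E E, a ∈ G.source ∧ (∀ x, G x = f x) ∧
      (∀ x ∈ G.source, ContDiffAt ℂ ω G x) ∧ ∀ x ∈ G.target, ContDiffAt ℂ ω G.symm x := by
  have hn : (ω : WithTop ℕ∞) ≠ 0 := by simp
  have hf'' : HasFDerivAt f (ContinuousLinearEquiv.refl ℂ E : E →L[ℂ] E) a := hf'
  let G₀ := hf.toOpenPartialHomeomorph f hf'' hn
  have ha : a ∈ G₀.source := hf.mem_toOpenPartialHomeomorph_source hf'' hn
  have hsymm : ContDiffAt ℂ ω G₀.symm (G₀ a) := hf.to_localInverse hf'' hn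
  have h₁ := hf.eventually (by simp)
  have h₂ := hsymm.eventually (by simp)
  obtain ⟨s, hs, hso, has⟩ := eventually_nhds_iff.mp (h₁.and ((G₀.continuousAt ha).eventually h₂))
  refine ⟨G₀.restrOpen s hso, ⟨ha, has⟩, fun x ↦ rfl, fun x hx ↦ (hs x hx.2).1, fun x hx ↦ ?_⟩
  rw [OpenPartialHomeomorph.restrOpen] at hx
  have hx' : x ∈ G₀.target ∧ G₀.symm x ∈ s := by simpa using hx
  have := (hs _ hx'.2).2
  rwa [G₀.right_inv hx'.1] at this

end LocalInverse

/-! ### Charts, differentials and tangent spaces of submanifolds -/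

namespace ComplexManifold

variable {E : Type u} [NormedAddCommGroup E] [NormedSpace ℂ E]
  {X : Type v} [TopologicalSpace X] [ChartedSpace E X]
  {F : Type*} [NormedAddCommGroup F] [NormedSpace ℂ F]
  {φ : OpenPartialHomeomorph X E} {x : X}

theorem contDiffAt_comp_symm (hφ : φ ∈ IsManifold.maximalAtlas 𝓘(ℂ, E) ω X) (hx : x ∈ φ.source)
    {f : X → F} (hf : ContMDiffAt 𝓘(ℂ, E) 𝓘(ℂ, F) ω f x) :
    ContDiffAt ℂ ω (f ∘ φ.symm) (φ x) := by
  rw [← contMDiffAt_iff_contDiffAt]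
  refine ContMDiffAt.comp (φ x) ?_ (contMDiffAt_symm_of_mem_maximalAtlas hφ (φ.map_source hx))
  rwa [φ.left_inv hx]

theorem contMDiffAt_comp_chart (hφ : φ ∈ IsManifold.maximalAtlas 𝓘(ℂ, E) ω X)
    (hx : x ∈ φ.source) {g : E → F} (hg : ContDiffAt ℂ ω g (φ x)) :
    ContMDiffAt 𝓘(ℂ, E) 𝓘(ℂ, F) ω (g ∘ φ) x :=
  (contMDiffAt_iff_contDiffAt.mpr hg).comp x (contMDiffAt_of_mem_maximalAtlas hφ hx)

/-- The differential of a chart. -/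
noncomputable def chartDeriv (φ : OpenPartialHomeomorph X E) (x : X) :
    TangentSpace 𝓘(ℂ, E) x →L[ℂ] E :=
  mfderiv 𝓘(ℂ, E) 𝓘(ℂ, E) φ x

theorem mfderiv_comp_chart (hφ : φ ∈ IsManifold.maximalAtlas 𝓘(ℂ, E) ω X) (hx : x ∈ φ.source)
    {g : E → F} (hg : DifferentiableAt ℂ g (φ x)) (v : TangentSpace 𝓘(ℂ, E) x) :
    mfderiv 𝓘(ℂ, E) 𝓘(ℂ, F) (g ∘ φ) x v = fderiv ℂ g (φ x) (chartDeriv φ x v) := by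
  rw [mfderiv_comp x (I' := 𝓘(ℂ, E)) hg.mdifferentiableAt
    ((contMDiffAt_of_mem_maximalAtlas hφ hx).mdifferentiableAt (by simp)), mfderiv_eq_fderiv]
  rfl

theorem mfderiv_eq_fderiv_comp_symm (hφ : φ ∈ IsManifold.maximalAtlas 𝓘(ℂ, E) ω X)
    (hx : x ∈ φ.source) {f : X → F} (hf : ContMDiffAt 𝓘(ℂ, E) 𝓘(ℂ, F) ω f x)
    (v : TangentSpace 𝓘(ℂ, E) x) :
    mfderiv 𝓘(ℂ, E) 𝓘(ℂ, F) f x v = fderiv ℂ (f ∘ φ.symm) (φ x) (chartDeriv φ x v) := by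
  have h : (f ∘ φ.symm) ∘ φ =ᶠ[𝓝 x] f := by
    filter_upwards [φ.open_source.mem_nhds hx] with y hy
    simp [φ.left_inv hy]
  rw [← mfderiv_comp_chart hφ hx ((contDiffAt_comp_symm hφ hx hf).differentiableAt (by simp)),
    h.mfderiv_eq]
  rfl

theorem chartDeriv_surjective (hφ : φ ∈ IsManifold.maximalAtlas 𝓘(ℂ, E) ω X)
    (hx : x ∈ φ.source) : Function.Surjective (chartDeriv φ x) := by
  have h : φ.MDifferentiable 𝓘(ℂ, E) 𝓘(ℂ, E) :=
    ⟨(contMDiffOn_of_mem_maximalAtlas hφ).mdifferentiableOn (by simp),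
      (contMDiffOn_symm_of_mem_maximalAtlas hφ).mdifferentiableOn (by simp)⟩
  exact h.mfderiv_surjective hx

theorem mem_tangentSubspace_iff {S : Set X} {v : TangentSpace 𝓘(ℂ, E) x} :
    v ∈ tangentSubspace E S x ↔ ∀ f : X → ℂ, ContMDiffAt 𝓘(ℂ, E) 𝓘(ℂ, ℂ) ω f x →
      (∀ᶠ y in 𝓝 x, y ∈ S → f y = 0) → mfderiv 𝓘(ℂ, E) 𝓘(ℂ, ℂ) f x v = 0 := by
  simp only [tangentSubspace, Submodule.mem_iInf]
  rfl

/-- The tangent space of a submanifold contains the directions of its slice charts. -/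
theorem mem_tangentSubspace_of_chartDeriv_mem (hφ : φ ∈ IsManifold.maximalAtlas 𝓘(ℂ, E) ω X)
    (hx : x ∈ φ.source) {S : Set X} {V : Submodule ℂ E} (hxS : x ∈ S)
    (hS : ∀ y ∈ φ.source, y ∈ S ↔ φ y ∈ V) {v : TangentSpace 𝓘(ℂ, E) x}
    (hv : chartDeriv φ x v ∈ V) : v ∈ tangentSubspace E S x := by
  refine mem_tangentSubspace_iff.mpr fun f hf h ↦ ?_
  rw [mfderiv_eq_fderiv_comp_symm hφ hx hf]
  set u := chartDeriv φ x v
  have hd := ((contDiffAt_comp_symm hφ hx hf).differentiableAt (by simp)).hasFDerivAt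
  -- The line through `φ x` in direction `u` stays in `V`, so `f` vanishes along it near `0`, and so
  -- does its derivative.
  have hline : HasDerivAt (fun t : ℂ ↦ φ x + t • u) u 0 := by
    simpa using ((hasDerivAt_id (0 : ℂ)).smul_const u).const_add (φ x)
  have hcomp : HasDerivAt ((f ∘ φ.symm) ∘ fun t : ℂ ↦ φ x + t • u)
      (fderiv ℂ (f ∘ φ.symm) (φ x) u) 0 :=
    HasFDerivAt.comp_hasDerivAt 0 (by simpa using hd) hline
  have hcont : Filter.Tendsto (fun t : ℂ ↦ φ x + t • u) (𝓝 0) (𝓝 (φ x)) := by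
    simpa using hline.continuousAt.tendsto
  have hsymm : Filter.Tendsto φ.symm (𝓝 (φ x)) (𝓝 x) := by
    simpa [φ.left_inv hx] using (φ.continuousAt_symm (φ.map_source hx)).tendsto
  have hzero : ((f ∘ φ.symm) ∘ fun t : ℂ ↦ φ x + t • u) =ᶠ[𝓝 0] fun _ ↦ 0 := by
    filter_upwards [hcont.eventually (hsymm.eventually h),
      hcont.eventually (φ.open_target.mem_nhds (φ.map_source hx))] with t ht ht'
    refine ht ((hS _ (φ.map_target ht')).mpr ?_)
    rw [φ.right_inv ht']
    exact V.add_mem ((hS x hx).mp hxS) (V.smul_mem _ hv)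
  exact (hcomp.congr_of_eventuallyEq hzero.symm).unique (hasDerivAt_const 0 (0 : ℂ))

/-- The tangent space of a submanifold is contained in the directions of its slice charts. -/
theorem chartDeriv_mem_of_mem_tangentSubspace [FiniteDimensional ℂ E]
    (hφ : φ ∈ IsManifold.maximalAtlas 𝓘(ℂ, E) ω X)
    (hx : x ∈ φ.source) {S : Set X} {V : Submodule ℂ E} (hS : ∀ y ∈ φ.source, y ∈ S ↔ φ y ∈ V)
    {v : TangentSpace 𝓘(ℂ, E) x} (hv : v ∈ tangentSubspace E S x) : chartDeriv φ x v ∈ V := by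
  by_contra hne
  -- A linear form separating the vector from `V`, read in the chart, vanishes on `S` near `x` and
  -- so contradicts tangency.
  obtain ⟨l, hl, hlV⟩ := Submodule.exists_le_ker_of_notMem hne
  apply hl
  have hdiff : ContDiff ℂ ω l.toContinuousLinearMap := l.toContinuousLinearMap.contDiff
  have := mem_tangentSubspace_iff.mp hv (l.toContinuousLinearMap ∘ φ)
    (contMDiffAt_comp_chart hφ hx hdiff.contDiffAt) (by
      filter_upwards [φ.open_source.mem_nhds hx] with y hy hyS
      exact hlV ((hS y hy).mp hyS))
  rw [mfderiv_comp_chart hφ hx l.toContinuousLinearMap.differentiableAt,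
    ContinuousLinearMap.fderiv] at this
  exact this

variable [IsManifold 𝓘(ℂ, E) ω X]

theorem trans_mem_maximalAtlas (hφ : φ ∈ IsManifold.maximalAtlas 𝓘(ℂ, E) ω X)
    {G : OpenPartialHomeomorph E E} (h₁ : ∀ e ∈ G.source, ContDiffAt ℂ ω G e)
    (h₂ : ∀ e ∈ G.target, ContDiffAt ℂ ω G.symm e) :
    φ.trans G ∈ IsManifold.maximalAtlas 𝓘(ℂ, E) ω X := by
  refine OpenPartialHomeomorph.mem_maximalAtlas_of_contMDiffOn _ (fun y hy ↦ ?_) fun e he ↦ ?_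
  · rw [OpenPartialHomeomorph.trans_source] at hy
    exact (contMDiffAt_comp_chart hφ hy.1 (h₁ _ hy.2)).contMDiffWithinAt
  · rw [OpenPartialHomeomorph.trans_target] at he
    exact ((contMDiffAt_symm_of_mem_maximalAtlas hφ he.2).comp e
      (contMDiffAt_iff_contDiffAt.mpr (h₂ e he.1))).contMDiffWithinAt

theorem restrOpen_mem_maximalAtlas (hφ : φ ∈ IsManifold.maximalAtlas 𝓘(ℂ, E) ω X) {s : Set X}
    (hs : IsOpen s) : φ.restrOpen s hs ∈ IsManifold.maximalAtlas 𝓘(ℂ, E) ω X := by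
  refine OpenPartialHomeomorph.mem_maximalAtlas_of_contMDiffOn _
    ((contMDiffOn_of_mem_maximalAtlas hφ).mono fun y hy ↦ hy.1)
    ((contMDiffOn_symm_of_mem_maximalAtlas hφ).mono fun y hy ↦ ?_)
  rw [OpenPartialHomeomorph.restrOpen] at hy
  have : y ∈ φ.target ∧ φ.symm y ∈ s := by simpa using hy
  exact this.1

end ComplexManifold

/-! ### Straightening a clean intersection -/

namespace ComplexManifold

variable {E : Type u} [NormedAddCommGroup E] [NormedSpace ℂ E] [FiniteDimensional ℂ E]

/-- Near `a`, the equations `F = 0` can be made linear by a coordinate change that preserves `B`,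
if the differential of `F` at `a` has a right inverse with values in `B`. -/
theorem exists_straightening {r : ℕ} (B : Submodule ℂ E) {F : E → Fin r → ℂ} {a : E}
    (hF : ContDiffAt ℂ ω F a) (s : (Fin r → ℂ) →L[ℂ] E) (hsB : ∀ c, s c ∈ B)
    (hs : ∀ c, fderiv ℂ F a (s c) = c) :
    ∃ (G : OpenPartialHomeomorph E E) (P : E →L[ℂ] E), a ∈ G.source ∧
      (∀ x ∈ G.source, ContDiffAt ℂ ω G x) ∧ (∀ x ∈ G.target, ContDiffAt ℂ ω G.symm x) ∧
      fderiv ℂ G a = ContinuousLinearMap.id ℂ E ∧ (∀ e, G e ∈ B ↔ e ∈ B) ∧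
      (∀ e, P (P e) = P e) ∧ (∀ e, e - P e ∈ B) ∧ (∀ e, F e = 0 → P (G e) = G e) ∧
      ∀ e, P e = e → fderiv ℂ F a e = 0 := by
  have : CompleteSpace E := FiniteDimensional.complete ℂ E
  set D := fderiv ℂ F a
  -- `P` projects onto `ker D` along the image of `s`. The map `g` equals `e + s (F e - D e)`: its
  -- derivative at `a` is the identity, it moves points only along `B`, and on `F = 0` it equals
  -- `P`.
  let P : E →L[ℂ] E := ContinuousLinearMap.id ℂ E - s.comp D
  have hP (e : E) : P e = e - s (D e) := rfl
  let g : E → E := fun e ↦ P e + s (F e)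
  have hd : HasFDerivAt g (ContinuousLinearMap.id ℂ E) a := by
    have h := P.hasFDerivAt (x := a).add
      (s.hasFDerivAt.comp a (hF.differentiableAt (by simp)).hasFDerivAt)
    rwa [show P + s.comp (fderiv ℂ F a) = ContinuousLinearMap.id ℂ E from sub_add_cancel _ _] at h
  have hg : ContDiffAt ℂ ω g a := P.contDiff.contDiffAt.add (s.contDiff.contDiffAt.comp a hF)
  obtain ⟨G, ha, hGg, h₁, h₂⟩ := exists_openPartialHomeomorph_of_contDiffAt hg hd
  have hGg' : (G : E → E) = g := funext hGg
  refine ⟨G, P, ha, h₁, h₂, hGg' ▸ hd.fderiv, fun e ↦ ?_, fun e ↦ ?_, fun e ↦ ?_, fun e he ↦ ?_,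
    fun e he ↦ ?_⟩
  · have : G e = e + (s (F e) - s (D e)) := by
      rw [hGg]
      simp only [g, hP]
      abel
    rw [this]
    exact B.add_mem_iff_left (B.sub_mem (hsB _) (hsB _))
  · simp [hP, hs]
  · simpa [hP] using hsB _
  · simp [hGg, g, hP, he, hs]
  · have : s (D e) = 0 := by simpa [hP] using he
    rw [← hs (D e), this, map_zero]

/-- A submanifold that is contained in a linear subspace, and has the same tangent space at a
point, coincides with the subspace near that point. -/
theorem eventually_mem_of_forall_exists_fderiv_eq {V M : Submodule ℂ E} {τ : E → E} {b : E}
    (hb : b ∈ V) (hτ : ContDiffAt ℂ ω τ b)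
    (h : ∀ m ∈ M, ∃ u ∈ V, fderiv ℂ τ b u = m) {N : Set E} (hN : N ∈ 𝓝 b)
    (hNM : ∀ v ∈ V, v ∈ N → τ v ∈ M) :
    ∀ᶠ z in 𝓝 (τ b), z ∈ M → ∃ v ∈ V, v ∈ N ∧ τ v = z := by
  have : CompleteSpace V := FiniteDimensional.complete ℂ V
  have : CompleteSpace M := FiniteDimensional.complete ℂ M
  obtain ⟨π', hπ'⟩ := M.subtype.exists_leftInverse_of_injective M.ker_subtype
  let π : E →L[ℂ] M := π'.toContinuousLinearMap
  have hπ (m : E) (hm : m ∈ M) : π m = ⟨m, hm⟩ := congr($hπ' ⟨m, hm⟩)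
  -- Composing with a projection onto `M` gives a map `V → M` with surjective derivative at `b`,
  -- hence open there. On `N` the projection changes nothing, since `τ` already lands in `M`.
  let θ : V → M := fun v ↦ π (τ v)
  have hθ : HasStrictFDerivAt θ (π.comp ((fderiv ℂ τ b).comp V.subtypeL)) ⟨b, hb⟩ :=
    π.hasStrictFDerivAt.comp _
      (HasStrictFDerivAt.comp (f := V.subtypeL) (⟨b, hb⟩ : V) (hτ.hasStrictFDerivAt (by simp))
        V.subtypeL.hasStrictFDerivAt)
  have hmap := hθ.map_nhds_eq_of_surj (by
    refine LinearMap.range_eq_top.mpr fun m ↦ ?_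
    obtain ⟨u, hu, hum⟩ := h m m.2
    exact ⟨⟨u, hu⟩, by simp [hum, hπ]⟩)
  have himage : θ '' (Subtype.val ⁻¹' N) ∈ 𝓝 (θ ⟨b, hb⟩) :=
    hmap ▸ Filter.image_mem_map (continuous_subtype_val.continuousAt.preimage_mem_nhds hN)
  filter_upwards [π.continuous.continuousAt.preimage_mem_nhds himage] with z ⟨v, hvN, hvz⟩ hz
  refine ⟨v, v.2, hvN, ?_⟩
  simp only [θ] at hvz
  rw [hπ _ (hNM v v.2 hvN), hπ z hz] at hvz
  exact congrArg Subtype.val hvz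

variable {X : Type v} [TopologicalSpace X] [ChartedSpace E X] [IsManifold 𝓘(ℂ, E) ω X]

/-- Around a point of a clean intersection `S ∩ T` there is a chart in which `T` is a linear
subspace `B`, `S` lies in the image of a projection `P` along a subspace of `B`, and `S ∩ T` is
the intersection of `B` with that image. -/
theorem exists_chart_of_tangentSubspace_inter {S T : Set X} {w : X} (hw : w ∈ S ∩ T)
    {φ ψ : OpenPartialHomeomorph X E} (hψ : ψ ∈ IsManifold.maximalAtlas 𝓘(ℂ, E) ω X)
    (hwψ : w ∈ ψ.source) {B : Submodule ℂ E} (hT : ∀ y ∈ ψ.source, y ∈ T ↔ ψ y ∈ B)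
    (hφ : φ ∈ IsManifold.maximalAtlas 𝓘(ℂ, E) ω X) (hwφ : w ∈ φ.source) {V : Submodule ℂ E}
    (hW : ∀ y ∈ φ.source, y ∈ S ∩ T ↔ φ y ∈ V)
    (htan : tangentSubspace E S w ⊓ tangentSubspace E T w ≤ tangentSubspace E (S ∩ T) w) :
    ∃ Φ ∈ IsManifold.maximalAtlas 𝓘(ℂ, E) ω X, w ∈ Φ.source ∧ ∃ P : E →L[ℂ] E,
      (∀ e, P (P e) = P e) ∧ (∀ e, e - P e ∈ B) ∧ (∀ y ∈ Φ.source, y ∈ T ↔ Φ y ∈ B) ∧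
      (∀ y ∈ Φ.source, y ∈ S → P (Φ y) = Φ y) ∧
      ∀ y ∈ Φ.source, P (Φ y) = Φ y → y ∈ T → y ∈ S := by
  -- All functions vanishing on `S` near `w`: the common kernel of their differentials is `T_S` by
  -- definition, and `B` is `T_T` in the chart `ψ`.
  let ι := {f : X → ℂ // ContMDiffAt 𝓘(ℂ, E) 𝓘(ℂ, ℂ) ω f w ∧ ∀ᶠ y in 𝓝 w, y ∈ S → f y = 0}
  obtain ⟨r, f, s, hsB, hs, hker⟩ := exists_rightInverse_of_forms B
    fun f : ι ↦ (fderiv ℂ (f.1 ∘ ψ.symm) (ψ w)).toLinearMap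
  let F : E → Fin r → ℂ := fun e i ↦ (f i).1 (ψ.symm e)
  have hFi (i : Fin r) : ContDiffAt ℂ ω (fun e ↦ F e i) (ψ w) :=
    contDiffAt_comp_symm hψ hwψ (f i).2.1
  have hF : ContDiffAt ℂ ω F (ψ w) := contDiffAt_pi.mpr hFi
  have hDF (e : E) (i : Fin r) :
      fderiv ℂ F (ψ w) e i = fderiv ℂ ((f i).1 ∘ ψ.symm) (ψ w) e :=
    congr($((hasFDerivAt_pi'.mp (hF.differentiableAt (by simp)).hasFDerivAt i).fderiv) e).symm
  obtain ⟨G, P, hGa, hG, hGsymm, hGid, hGB, hPP, hPB, hFP, hPD⟩ :=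
    exists_straightening B hF s.toContinuousLinearMap hsB fun c ↦ by
      ext i
      rw [hDF]
      exact hs c i
  let Φ := ψ.trans G
  have hΦ : Φ ∈ IsManifold.maximalAtlas 𝓘(ℂ, E) ω X := trans_mem_maximalAtlas hψ hG hGsymm
  have hwΦ : w ∈ Φ.source := by
    rw [OpenPartialHomeomorph.trans_source]
    exact ⟨hwψ, hGa⟩
  have hΦψ {y : X} (hy : y ∈ Φ.source) : y ∈ ψ.source := by
    rw [OpenPartialHomeomorph.trans_source] at hy
    exact hy.1
  have hΦT (y : X) (hy : y ∈ Φ.source) : y ∈ T ↔ Φ y ∈ B :=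
    (hT y (hΦψ hy)).trans (hGB (ψ y)).symm
  have hΦS : ∀ᶠ y in 𝓝 w, y ∈ S → P (Φ y) = Φ y := by
    filter_upwards [Filter.eventually_all.mpr fun i ↦ (f i).2.2,
      ψ.open_source.mem_nhds hwψ] with y hy hyψ hyS
    refine hFP _ (funext fun i ↦ ?_)
    change (f i).1 (ψ.symm (ψ y)) = 0
    rw [ψ.left_inv hyψ]
    exact hy i hyS
  let M : Submodule ℂ E := LinearMap.eqLocus P.toLinearMap LinearMap.id ⊓ B
  have hwV : φ w ∈ V := (hW w hwφ).mp hw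
  have hcomp : ContMDiffAt 𝓘(ℂ, E) 𝓘(ℂ, E) ω (G ∘ ψ) w := contMDiffAt_comp_chart hψ hwψ (hG _ hGa)
  -- The transition from the chart `φ`, where `W` is the subspace `V`, to `Φ`, where `W` should fill
  -- `M = im P ∩ B`.
  let τ : E → E := (G ∘ ψ) ∘ φ.symm
  have hτ : ContDiffAt ℂ ω τ (φ w) := contDiffAt_comp_symm hφ hwφ hcomp
  have hτw : τ (φ w) = Φ w := by
    simp only [τ, Function.comp_apply, φ.left_inv hwφ]
    rfl
  -- A vector of `M` is killed by the chosen differentials and lies in `B`, hence is killed by all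
  -- of them: it is in `T_S ∩ T_T`, so in `T_W`, that is, in `V` as seen by `φ`. As `dG` is the
  -- identity at the point, `m` means the same in `ψ` and in `Φ`.
  have hsurj (m : E) (hm : m ∈ M) : ∃ u ∈ V, fderiv ℂ τ (φ w) u = m := by
    obtain ⟨v, hv⟩ := chartDeriv_surjective hψ hwψ m
    have hvS : v ∈ tangentSubspace E S w := mem_tangentSubspace_iff.mpr fun f' hf' hf'S ↦ by
      rw [mfderiv_eq_fderiv_comp_symm hψ hwψ hf', hv]
      refine hker m hm.2 (fun i ↦ ?_) ⟨f', hf', hf'S⟩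
      have := congr($(hPD m hm.1) i)
      rwa [hDF] at this
    have hvT : v ∈ tangentSubspace E T w :=
      mem_tangentSubspace_of_chartDeriv_mem hψ hwψ hw.2 hT (hv ▸ hm.2)
    refine ⟨chartDeriv φ w v, chartDeriv_mem_of_mem_tangentSubspace hφ hwφ hW (htan ⟨hvS, hvT⟩), ?_⟩
    have h₁ := mfderiv_eq_fderiv_comp_symm hφ hwφ hcomp v
    have h₂ := mfderiv_comp_chart hψ hwψ ((hG _ hGa).differentiableAt (by simp)) v
    rw [hGid, hv] at h₂
    exact h₁.symm.trans h₂
  let N : Set E := {v | v ∈ φ.target ∧ φ.symm v ∈ Φ.source ∧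
    (φ.symm v ∈ S → P (Φ (φ.symm v)) = Φ (φ.symm v))}
  have hN : N ∈ 𝓝 (φ w) := by
    have hsymm : Filter.Tendsto φ.symm (𝓝 (φ w)) (𝓝 w) := by
      simpa [φ.left_inv hwφ] using (φ.continuousAt_symm (φ.map_source hwφ)).tendsto
    filter_upwards [φ.open_target.mem_nhds (φ.map_source hwφ),
      hsymm.eventually (Φ.open_source.mem_nhds hwΦ), hsymm.eventually hΦS] with v h₁ h₂ h₃
    exact ⟨h₁, h₂, h₃⟩
  have hVW (v : E) (hv : v ∈ V) (hvN : v ∈ N) : φ.symm v ∈ S ∩ T := by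
    rw [hW _ (φ.map_target hvN.1), φ.right_inv hvN.1]
    exact hv
  have hev := eventually_mem_of_forall_exists_fderiv_eq (M := M) hwV hτ hsurj hN fun v hv hvN ↦
      ⟨hvN.2.2 (hVW v hv hvN).1, (hΦT _ hvN.2.1).mp (hVW v hv hvN).2⟩
  rw [hτw] at hev
  obtain ⟨O, hO, hOo, hwO⟩ := eventually_nhds_iff.mp
    (hΦS.and ((Φ.continuousAt hwΦ).eventually hev))
  refine ⟨Φ.restrOpen O hOo, restrOpen_mem_maximalAtlas hΦ hOo, ⟨hwΦ, hwO⟩, P, hPP, hPB,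
    fun y hy ↦ hΦT y hy.1, fun y hy ↦ (hO y hy.2).1, fun y hy hPy hyT ↦ ?_⟩
  obtain ⟨v, hv, hvN, hvy⟩ := (hO y hy.2).2 ⟨hPy, (hΦT y hy.1).mp hyT⟩
  have : φ.symm v = y := Φ.injOn hvN.2.1 hy.1 hvy
  exact this ▸ (hVW v hv hvN).1

end ComplexManifold

/-! ### Vanishing ideals and the theorem for manifolds -/

namespace ComplexManifold

section VanishingIdeal

variable {E : Type u} [NormedAddCommGroup E] [NormedSpace ℂ E]
  {X : Type v} [TopologicalSpace X] [ChartedSpace E X] {x : X}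

theorem vanishingIdeal_anti {A B : Set X} (h : ∀ᶠ y in 𝓝 x, y ∈ A → y ∈ B) :
    vanishingIdeal E B x ≤ vanishingIdeal E A x := by
  rintro _ ⟨f, hf, hB⟩
  refine ⟨f, hf, ?_⟩
  filter_upwards [h, hB] with y h₁ h₂ hy using h₂ (h₁ hy)

theorem vanishingIdeal_eq_top {A : Set X} (h : ∀ᶠ y in 𝓝 x, y ∉ A) :
    vanishingIdeal E A x = ⊤ := by
  rw [Ideal.eq_top_iff_one]
  refine ⟨fun _ ↦ 1, rfl, ?_⟩
  filter_upwards [h] with y hy hyA using absurd hyA hy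

/-- A germ that splits into holomorphic functions vanishing on `A` and on `B` lies in the sum of
the ideals of `A` and `B`. -/
theorem vanishingIdeal_le_sup {W A B : Set X}
    (h : ∀ f : X → ℂ, ContMDiffAt 𝓘(ℂ, E) 𝓘(ℂ, ℂ) ω f x → (∀ᶠ y in 𝓝 x, y ∈ W → f y = 0) →
      ∃ g : X → ℂ, ContMDiffAt 𝓘(ℂ, E) 𝓘(ℂ, ℂ) ω g x ∧ (∀ᶠ y in 𝓝 x, y ∈ B → g y = 0) ∧
        ∀ᶠ y in 𝓝 x, y ∈ A → f y = g y) :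
    vanishingIdeal E W x ≤ vanishingIdeal E A x ⊔ vanishingIdeal E B x := by
  rintro ⟨_, f, hf, rfl⟩ ⟨f', hff', hf'⟩
  have hfW : ∀ᶠ y in 𝓝 x, y ∈ W → f y = 0 := by
    filter_upwards [hf', Filter.Germ.coe_eq.mp hff'] with y h₁ h₂ hy
    rw [← h₂, h₁ hy]
  obtain ⟨g, hg, hgB, hfg⟩ := h f hf hfW
  let γ : holomorphicGerms E x := ⟨g, g, hg, rfl⟩
  let δ : holomorphicGerms E x := ⟨(f - g : X → ℂ), f - g, hf.sub hg, rfl⟩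
  have hδγ : (⟨f, f, hf, rfl⟩ : holomorphicGerms E x) = δ + γ := by
    refine Subtype.ext ?_
    change (f : Filter.Germ (𝓝 x) ℂ) = ((f - g + g : X → ℂ) : Filter.Germ (𝓝 x) ℂ)
    rw [sub_add_cancel]
  rw [hδγ]
  refine Submodule.add_mem_sup ⟨f - g, rfl, ?_⟩ ⟨g, rfl, hgB⟩
  filter_upwards [hfg] with y hy hyA
  simp [hy hyA]

/-- If `S ∩ T` is the intersection of two linear subspaces in some chart, then its ideal is the
sum of their ideals. -/
theorem vanishingIdeal_eq_sup {W A B : Set X} {φ : OpenPartialHomeomorph X E}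
    (hφ : φ ∈ IsManifold.maximalAtlas 𝓘(ℂ, E) ω X) (hx : x ∈ φ.source) (P : E →L[ℂ] E)
    (hA : ∀ y ∈ φ.source, y ∈ A → P (φ y) = φ y)
    (hB : ∀ y ∈ φ.source, y ∈ B → ∀ z ∈ φ.source, φ z = P (φ y) → z ∈ W)
    (hWA : ∀ y ∈ φ.source, y ∈ W → y ∈ A) (hWB : ∀ y ∈ φ.source, y ∈ W → y ∈ B) (hxW : x ∈ W) :
    vanishingIdeal E W x = vanishingIdeal E A x ⊔ vanishingIdeal E B x := by
  have hsrc := φ.open_source.mem_nhds hx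
  refine le_antisymm (vanishingIdeal_le_sup fun f hf hfW ↦ ?_)
    (sup_le (vanishingIdeal_anti (by filter_upwards [hsrc] using hWA))
      (vanishingIdeal_anti (by filter_upwards [hsrc] using hWB)))
  have hPx : P (φ x) = φ x := hA x hx (hWA x hx hxW)
  have hF : ContDiffAt ℂ ω (f ∘ φ.symm) (P (φ x)) := by
    rw [hPx]
    exact contDiffAt_comp_symm hφ hx hf
  have hPφ : Filter.Tendsto (fun y ↦ P (φ y)) (𝓝 x) (𝓝 (φ x)) := by
    have := (P.continuous.continuousAt.comp (φ.continuousAt hx)).tendsto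
    rwa [Function.comp_apply, hPx] at this
  have hsymm : Filter.Tendsto φ.symm (𝓝 (φ x)) (𝓝 x) := by
    simpa [φ.left_inv hx] using (φ.continuousAt_symm (φ.map_source hx)).tendsto
  -- The witness is `f ∘ P` in the chart. It equals `f` on `A`, where `P` is the identity, and
  -- vanishes on `B` because `P` carries points of `B` into `W`.
  refine ⟨((f ∘ φ.symm) ∘ P) ∘ φ,
    contMDiffAt_comp_chart hφ hx (hF.comp (φ x) P.contDiff.contDiffAt), ?_, ?_⟩
  · filter_upwards [hsrc, hPφ.eventually (φ.open_target.mem_nhds (φ.map_source hx)),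
      hPφ.eventually (hsymm.eventually hfW)] with y hy hy' hyW hyB
    exact hyW (hB y hy hyB _ (φ.map_target hy') (φ.right_inv hy'))
  · filter_upwards [hsrc] with y hy hyA
    simp [hA y hy hyA, φ.left_inv hy]

end VanishingIdeal

variable {E : Type u} [NormedAddCommGroup E] [NormedSpace ℂ E] [FiniteDimensional ℂ E]
  {X : Type v} [TopologicalSpace X] [ChartedSpace E X] [IsManifold 𝓘(ℂ, E) ω X]

/-- In the straightened chart `Y`, `T` and `W` are the subspaces `im P`, `B` and their intersection,
so one chart serves every point of `U` as slice chart for all three. -/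
theorem exists_submanifold_containing {S T : Set X} (hT : IsClosed T) (hT' : IsSubmanifold E T)
    (hW : IsSubmanifold E (S ∩ T)) {w : X} (hw : w ∈ S ∩ T)
    (htan : tangentSubspace E S w ⊓ tangentSubspace E T w ≤ tangentSubspace E (S ∩ T) w) :
    ∃ U : Set X, IsOpen U ∧ w ∈ U ∧ ∃ (Y : Set X) (dY dT dW : ℕ),
      Y ⊆ U ∧ closure Y ∩ U ⊆ Y ∧ IsSubmanifoldOfDim E Y dY ∧ S ∩ U ⊆ Y ∧
      IsSchemeTheoreticInter E U (S ∩ T) Y T ∧ IsSubmanifoldOfDim E (T ∩ U) dT ∧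
      IsSubmanifoldOfDim E (S ∩ T ∩ U) dW ∧ dY + dT = Module.finrank ℂ E + dW := by
  obtain ⟨_, ψ, hψ, hwψ, B, -, hψT⟩ := hT' w hw.2
  obtain ⟨_, φ, hφ, hwφ, V, -, hφW⟩ := hW w hw
  obtain ⟨Φ, hΦ, hwΦ, P, hPP, hPB, hΦT, hΦS, hΦW⟩ :=
    exists_chart_of_tangentSubspace_inter hw hψ hwψ hψT hφ hwφ hφW htan
  let A : Submodule ℂ E := LinearMap.range P.toLinearMap
  have hA (e : E) : e ∈ A ↔ P e = e := ⟨fun ⟨z, hz⟩ ↦ hz ▸ hPP z, fun h ↦ ⟨e, h⟩⟩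
  have hPb {b : E} (hb : b ∈ B) : P b ∈ B := by
    rw [← sub_sub_cancel b (P b)]
    exact B.sub_mem hb (hPB b)
  let Y : Set X := {y | y ∈ Φ.source ∧ Φ y ∈ A}
  have hYW : S ∩ T ∩ Φ.source = Y ∩ T ∩ Φ.source := by
    ext y
    constructor
    · rintro ⟨⟨hS, hT⟩, hy⟩
      exact ⟨⟨⟨hy, (hA _).mpr (hΦS y hy hS)⟩, hT⟩, hy⟩
    · rintro ⟨⟨hY, hT⟩, hy⟩
      exact ⟨⟨hΦW y hy ((hA _).mp hY.2) hT, hT⟩, hy⟩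
  have hYclosed : closure Y ∩ Φ.source ⊆ Y := by
    rintro y ⟨hyY, hy⟩
    refine ⟨hy, (A.closed_of_finiteDimensional.closure_eq).subset ?_⟩
    exact closure_mono (Set.image_subset_iff.mpr fun z hz ↦ hz.2)
      (mem_closure_image (Φ.continuousAt hy) hyY)
  refine ⟨Φ.source, Φ.open_source, hwΦ, Y, Module.finrank ℂ A, Module.finrank ℂ B,
    Module.finrank ℂ (A ⊓ B : Submodule ℂ E), fun y hy ↦ hy.1, hYclosed, ?_, ?_, ⟨hYW, ?_⟩, ?_, ?_,
    finrank_range_add_finrank P.toLinearMap B hPB⟩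
  · exact fun x hx ↦ ⟨Φ, hΦ, hx.1, A, rfl, fun y hy ↦ ⟨fun h ↦ h.2, fun h ↦ ⟨hy, h⟩⟩⟩
  · exact fun y hy ↦ ⟨hy.2, (hA _).mpr (hΦS y hy.2 hy.1)⟩
  · intro x hx
    by_cases hxW : x ∈ S ∩ T
    · refine vanishingIdeal_eq_sup hΦ hx P (fun y _ hyY ↦ (hA _).mp hyY.2) ?_
        (fun y hy hyW ↦ (hYW.subset ⟨hyW, hy⟩).1.1) (fun y _ hyW ↦ hyW.2) hxW
      intro y hy hyT z hz hzy
      have hzT : z ∈ T := (hΦT z hz).mpr (hzy ▸ hPb ((hΦT y hy).mp hyT))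
      exact ⟨hΦW z hz (by rw [hzy, hPP]) hzT, hzT⟩
    -- Off `W`, one of `Y` and `T` misses a neighbourhood of `x`, so its ideal is the unit ideal;
    -- the larger ideal of `W` is then the unit ideal as well.
    · have hxYT : x ∉ Y ∨ x ∉ T := by
        by_contra! h
        exact hxW (hYW.superset ⟨h, hx⟩).1
      have key : vanishingIdeal E Y x ⊔ vanishingIdeal E T x = ⊤ := by
        rcases hxYT with h | h
        · rw [vanishingIdeal_eq_top (A := Y), top_sup_eq]
          filter_upwards [isClosed_closure.isOpen_compl.mem_nhds
            (fun hc ↦ h (hYclosed ⟨hc, hx⟩) : x ∈ (closure Y)ᶜ)] with y hy hyY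
          exact hy (subset_closure hyY)
        · rw [vanishingIdeal_eq_top (A := T), sup_top_eq]
          exact hT.isOpen_compl.mem_nhds h
      rw [key, eq_top_iff, ← key]
      refine sup_le (vanishingIdeal_anti ?_) (vanishingIdeal_anti ?_)
      · filter_upwards [Φ.open_source.mem_nhds hx] with y hy hyW using (hYW.subset ⟨hyW, hy⟩).1.1
      · exact .of_forall fun y hy ↦ hy.2
  · exact fun x hx ↦ ⟨Φ, hΦ, hx.2, B, rfl, fun y hy ↦
      ⟨fun h ↦ (hΦT y hy).mp h.1, fun h ↦ ⟨(hΦT y hy).mpr h, hy⟩⟩⟩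
  · refine fun x hx ↦ ⟨Φ, hΦ, hx.2, A ⊓ B, rfl, fun y hy ↦ ⟨fun h ↦ ?_, fun h ↦ ?_⟩⟩
    · exact ⟨(hYW.subset h).1.1.2, (hΦT y hy).mp h.1.2⟩
    · exact hYW.superset ⟨⟨⟨hy, h.1⟩, (hΦT y hy).mpr h.2⟩, hy⟩

end ComplexManifold

/-- The dimension equalities are written additively because subtraction is truncated in `ℕ`. In the
first half `w` runs over all points of `W`, closed or not. -/
theorem mainTheorem5 :
    -- smooth varieties over an algebraically closed field
    (∀ (k : Type u) [Field k] [IsAlgClosed k] (X S T : Scheme.{u})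
      (p : X ⟶ Spec (CommRingCat.of k)) (i : S ⟶ X) (j : T ⟶ X),
      IsSmoothVariety p →
      IsClosedImmersion i → IsSmoothVariety (i ≫ p) →
      IsClosedImmersion j → IsSmoothVariety (j ≫ p) →
      -- the scheme-theoretic intersection `W` of `S` and `T` is smooth
      Smooth (pullback.fst i j ≫ i ≫ p) →
      ∀ w : (pullback i j : Scheme.{u}),
      ∃ U : X.Opens, (pullback.fst i j ≫ i) w ∈ U ∧
      ∃ (Y : Scheme.{u}) (y : Y ⟶ (U : Scheme.{u})),
        IsClosedImmersion y ∧ IsSmoothVariety (y ≫ U.ι ≫ p) ∧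
        -- `S ∩ U ⊆ Y`
        (∃ g : ((i ⁻¹ᵁ U : S.Opens) : Scheme.{u}) ⟶ Y, g ≫ y = i ∣_ U) ∧
        -- `W ∩ U` is the scheme-theoretic intersection of `Y` and `T ∩ U`
        (∃ e : (((pullback.fst i j ≫ i) ⁻¹ᵁ U : (pullback i j).Opens) : Scheme.{u}) ≅
            pullback y (j ∣_ U),
          e.hom ≫ pullback.fst y (j ∣_ U) ≫ y = (pullback.fst i j ≫ i) ∣_ U) ∧
        -- `dim Y + dim T - dim X = dim (W ∩ U)`
        topologicalKrullDim Y + topologicalKrullDim T =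
          topologicalKrullDim X +
            topologicalKrullDim ((pullback.fst i j ≫ i) ⁻¹ᵁ U : (pullback i j).Opens)) ∧
    -- complex manifolds
    (∀ (E : Type u) [NormedAddCommGroup E] [NormedSpace ℂ E] [FiniteDimensional ℂ E]
      (X : Type v) [TopologicalSpace X] [ChartedSpace E X] [IsManifold 𝓘(ℂ, E) ω X]
      (S T : Set X),
      IsClosed S → ComplexManifold.IsSubmanifold E S →
      IsClosed T → ComplexManifold.IsSubmanifold E T →
      -- `W = S ∩ T` is smooth, and `T_W = T_S ∩ T_T`
      ComplexManifold.IsSubmanifold E (S ∩ T) →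
      (∀ w ∈ S ∩ T, ComplexManifold.tangentSubspace E (S ∩ T) w =
        ComplexManifold.tangentSubspace E S w ⊓ ComplexManifold.tangentSubspace E T w) →
      ∀ w ∈ S ∩ T, ∃ U : Set X, IsOpen U ∧ w ∈ U ∧
      ∃ (Y : Set X) (dY dT dW : ℕ),
        -- `Y` is a closed submanifold of `U`
        Y ⊆ U ∧ closure Y ∩ U ⊆ Y ∧ ComplexManifold.IsSubmanifoldOfDim E Y dY ∧
        S ∩ U ⊆ Y ∧
        ComplexManifold.IsSchemeTheoreticInter E U (S ∩ T) Y T ∧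
        ComplexManifold.IsSubmanifoldOfDim E (T ∩ U) dT ∧
        ComplexManifold.IsSubmanifoldOfDim E (S ∩ T ∩ U) dW ∧
        dY + dT = Module.finrank ℂ E + dW) := by
  refine ⟨fun k _ _ X S T p i j hp _ _ _ hT hW w ↦
    exists_smooth_closed_subscheme_containing p i j hp hT hW w, ?_⟩
  intro E _ _ _ X _ _ _ S T _ _ hT hT' hW htan w hw
  exact ComplexManifold.exists_submanifold_containing hT hT' hW hw (htan w hw).ge
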